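/- Let $p$ be a prime, let $K$ be a finite extension of $\mathbb Q_p$ with the absolute value extending the $p$-adic one, and let $\pi\in K$ satisfy $\pi^{p-1}+p=0$. Let $A=(w_{ij})$ be an $n\times N$ integer matrix of rank $n$ with columns $\mathbf w_1,\dots,\mathbf w_N\in\mathbb Z^n$, and let $\gamma_1,\dots,\gamma_n\in K$. For $r>0$ let $K\{r^{-1}\mathbf x\}$ be the space of power series $f=\sum_{\mathbf u\in\mathbb Z_{\ge 0}^N} a_{\mathbf u}\mathbf x^{\mathbf u}$ over $K$ with $\|f\|_r=\sup_{\mathbf u}|a_{\mathbf u}|r^{|\mathbf u|}<\infty$. Let $$\mathcal D^\dagger=\bigcup_{r>1,\,s>1}\Big\{\sum_{\mathbf v\in\mathbb Z_{\ge 0}^N} f_{\mathbf v}(\mathbf x)\frac{\partial^{\mathbf v}}{\pi^{|\mathbf v|}}:\ f_{\mathbf v}\in K\{r^{-1}\mathbf x\},\ \|f_{\mathbf v}\|_r s^{|\mathbf v|}\text{ bounded}\Big\},$$ a ring under composition of differential operators in $x_1,\dots,x_N$. Let $C(A)=\{\sum_j k_j\mathbf w_j: k_j\in\mathbb Z_{\ge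 0}\}$, let $\Delta\subset\mathbb R^n$ be the convex hull of $0,\mathbf w_1,\dots,\mathbf w_N$, put $d(\mathbf w)=\inf\{a>0:\mathbf w\in a\Delta\}$, and let $$L^{\dagger\prime}=\bigcup_{r>1,\,s>1}\Big\{\sum_{\mathbf w\in C(A)}a_{\mathbf w}(\mathbf x)\mathbf t^{\mathbf w}:\ a_{\mathbf w}\in K\{r^{-1}\mathbf x\},\ \|a_{\mathbf w}\|_r s^{d(\mathbf w)}\text{ bounded}\Big\},$$ a left $\mathcal D^\dagger$-module on which $\partial/\partial x_j$ acts as $\nabla_{\partial/\partial x_j}=\partial/\partial x_j+\pi\mathbf t^{\mathbf w_j}$. Put $F_{i,\gamma}=t_i\frac{\partial}{\partial t_i}+\gamma_i+\pi\sum_j w_{ij}x_j\mathbf t^{\mathbf w_j}$ on $L^{\dagger\prime}$. Let $C^\cdot(L^{\dagger\prime})$ be the twisted de Rham complex of $\mathcal D^\dagger$-modules, in which $C^k(L^{\dagger\prime})$ consists of the forms $\sum_{i_1<\dots<i_k} f_{i_1\dots i_k}\frac{dt_{i_1}}{t_{i_1}}\wedge\dots\wedge\frac{dt_{i_k}}{t_{i_k}}$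 with coefficients in $L^{\dagger\prime}$ and the differential is $f\omega\mapsto\sum_i F_{i,\gamma}(f)\frac{dt_i}{t_i}\wedge\omega$ for $\omega=\frac{dt_{i_1}}{t_{i_1}}\wedge\dots\wedge\frac{dt_{i_k}}{t_{i_k}}$. Let $\Lambda=\{\lambda\in\mathbb Z^N:\sum_j\lambda_j\mathbf w_j=0\}$ and, in $\mathcal D^\dagger$, let $$\Box_\lambda=\prod_{\lambda_j>0}\Big(\frac1\pi\frac{\partial}{\partial x_j}\Big)^{\lambda_j}-\prod_{\lambda_j<0}\Big(\frac1\pi\frac{\partial}{\partial x_j}\Big)^{-\lambda_j}\ (\lambda\in\Lambda),\qquad E_{i,\gamma}=\sum_j w_{ij}x_j\frac{\partial}{\partial x_j}+\gamma_i\ (1\le i\le n).$$ Theorem. The homomorphism of left $\mathcal D^\dagger$-modules $\varphi:\mathcal D^\dagger\to L^{\dagger\prime}$, $P\mapsto P\cdot 1$, induces isomorphisms of $\mathcal D^\dagger$-modules $$\mathcal D^\dagger\Big/\sum_{\lambda\in\Lambda}\mathcal D^\dagger\Box_\lambda\ \cong\ L^{\dagger\prime},\qquad \mathcal D^\dagger\Big/\Big(\sum_{i=1}^n\mathcal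 D^\dagger E_{i,\gamma}+\sum_{\lambda\in\Lambda}\mathcal D^\dagger\Box_\lambda\Big)\ \cong\ L^{\dagger\prime}\Big/\sum_{i=1}^nF_{i,\gamma}L^{\dagger\prime},$$ and $f\mapsto f\frac{dt_1}{t_1}\wedge\dots\wedge\frac{dt_n}{t_n}$ induces an isomorphism of $\mathcal D^\dagger$-modules $L^{\dagger\prime}/\sum_iF_{i,\gamma}L^{\dagger\prime}\cong H^n(C^\cdot(L^{\dagger\prime}))$. Moreover there are finitely many $\mu^{(1)},\dots,\mu^{(m)}\in\Lambda$ with $\sum_{i=1}^m\mathcal D^\dagger\Box_{\mu^{(i)}}=\sum_{\lambda\in\Lambda}\mathcal D^\dagger\Box_\lambda$. -/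

import Mathlib

open scoped MvPowerSeries.WithPiTopology

set_option linter.unusedSectionVars false

noncomputable section

namespace GKZ

/-- The roots `π ∈ K` of `π ^ (p - 1) + p = 0`. -/
abbrev DworkPi (p : ℕ) (K : Type*) [Field K] := {ϖ : K // ϖ ^ (p - 1) + (p : K) = 0}

/-- Formal sums `∑ₘ gₘ(x) Tᵐ`, with `m` in an index set `M` and with coefficients `gₘ(x)` formal
power series in `x₁, …, x_N` over `K`. -/
abbrev FormalSums (K : Type*) (N : ℕ) (M : Type*) := M → MvPowerSeries (Fin N) K

section General

variable {K : Type*} [NormedField K] {N : ℕ} {M : Type*}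

/-- For all `m` and `u`, the coefficient of `xᵘ Tᵐ` is bounded by `C r ^ (-|u|) s ^ (-ω(m))`;
in other words, every `gₘ` lies in `K{r⁻¹x}`, and `‖gₘ‖_r s ^ ω(m) ≤ C`. -/
def BoundedBy (ω : M → ℝ) (r s C : ℝ) (g : FormalSums K N M) : Prop :=
  ∀ (m : M) (u : Fin N →₀ ℕ), ‖MvPowerSeries.coeff u (g m)‖ * r ^ u.degree * s ^ ω m ≤ C

/-- The condition that there are `r > 1` and `s > 1` such that every `gₘ` lies in `K{r⁻¹x}`
and the numbers `‖gₘ‖_r s ^ ω(m)` are bounded. -/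
def IsOverconvergent (ω : M → ℝ) (g : FormalSums K N M) : Prop :=
  ∃ r > 1, ∃ s > 1, ∃ C, BoundedBy ω r s C g

theorem BoundedBy.mono_const {ω : M → ℝ} {r s C C' : ℝ} {g : FormalSums K N M}
    (h : BoundedBy ω r s C g) (hC : C ≤ C') : BoundedBy ω r s C' g :=
  fun m u => (h m u).trans hC

theorem BoundedBy.mono {ω : M → ℝ} (hω : ∀ m, 0 ≤ ω m) {r s r' s' C : ℝ} {g : FormalSums K N M}
    (h : BoundedBy ω r s C g) (hr' : 0 ≤ r') (hs' : 0 ≤ s') (hr : r' ≤ r) (hs : s' ≤ s) :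
    BoundedBy ω r' s' C g := by
  intro m u
  refine le_trans ?_ (h m u)
  have := hω m
  have hr0 : 0 ≤ r := hr'.trans hr
  gcongr

theorem BoundedBy.nonneg {ω : M → ℝ} {r s C : ℝ} {g : FormalSums K N M}
    (h : BoundedBy ω r s C g) (hr : 0 ≤ r) (hs : 0 ≤ s) [Nonempty M] : 0 ≤ C := by
  obtain ⟨m⟩ := ‹Nonempty M›
  refine le_trans ?_ (h m 0)
  positivity

theorem boundedBy_iff {ω : M → ℝ} {r s C : ℝ} {g : FormalSums K N M} (hr : 0 < r) (hs : 0 < s) :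
    BoundedBy ω r s C g ↔ ∀ (m : M) (u : Fin N →₀ ℕ),
      ‖MvPowerSeries.coeff u (g m)‖ ≤ C / (r ^ u.degree * s ^ ω m) := by
  refine forall_congr' fun m => forall_congr' fun u => ?_
  rw [le_div_iff₀ (by positivity), mul_assoc]

theorem BoundedBy.zero {ω : M → ℝ} {r s : ℝ} :
    BoundedBy ω r s 0 (0 : FormalSums K N M) := by
  intro m u
  simp

theorem BoundedBy.const_smul {ω : M → ℝ} {r s C : ℝ} {g : FormalSums K N M}
    (h : BoundedBy ω r s C g) (a : K) : BoundedBy ω r s (‖a‖ * C) (a • g) := by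
  intro m u
  have := h m u
  simp only [Pi.smul_apply, MvPowerSeries.coeff_smul, norm_mul]
  calc _ = ‖a‖ * (‖MvPowerSeries.coeff u (g m)‖ * r ^ u.degree * s ^ ω m) := by ring
    _ ≤ _ := by gcongr

/-- The overconvergent formal sums form a vector space. -/
def overconvergent (K : Type*) [NormedField K] (N : ℕ) (ω : M → ℝ)
    (hω : ∀ m, 0 ≤ ω m) : Submodule K (FormalSums K N M) where
  carrier := {g | IsOverconvergent ω g}
  zero_mem' := ⟨2, by norm_num, 2, by norm_num, 0, BoundedBy.zero⟩
  add_mem' := by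
    rintro g g' ⟨r, hr, s, hs, C, h⟩ ⟨r', hr', s', hs', C', h'⟩
    have h1 : (1 : ℝ) < min r r' := lt_min hr hr'
    have h2 : (1 : ℝ) < min s s' := lt_min hs hs'
    have h3 := h.mono (r' := min r r') (s' := min s s') hω (by positivity) (by positivity)
      (min_le_left _ _) (min_le_left _ _)
    have h4 := h'.mono (r' := min r r') (s' := min s s') hω (by positivity) (by positivity)
      (min_le_right _ _) (min_le_right _ _)
    refine ⟨min r r', h1, min s s', h2, C + C', fun m u => ?_⟩
    refine le_trans ?_ (add_le_add (h3 m u) (h4 m u))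
    rw [← add_mul, ← add_mul, Pi.add_apply, map_add]
    gcongr
    exact norm_add_le _ _
  smul_mem' := by
    rintro a g ⟨r, hr, s, hs, C, h⟩
    exact ⟨r, hr, s, hs, _, h.const_smul a⟩

section Ultra

variable [IsUltrametricDist K]

theorem BoundedBy.add {ω : M → ℝ} {r s C : ℝ} {g g' : FormalSums K N M} (hr : 0 < r)
    (hs : 0 < s) (h : BoundedBy ω r s C g) (h' : BoundedBy ω r s C g') :
    BoundedBy ω r s C (g + g') := by
  rw [boundedBy_iff hr hs] at *
  intro m u
  simp only [Pi.add_apply, map_add]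
  exact (IsUltrametricDist.norm_add_le_max _ _).trans (max_le (h m u) (h' m u))

theorem BoundedBy.sum {ω : M → ℝ} {r s C : ℝ} (hC : 0 ≤ C) (hr : 0 < r) (hs : 0 < s)
    {ι : Type*} (t : Finset ι) (G : ι → FormalSums K N M)
    (h : ∀ i ∈ t, BoundedBy ω r s C (G i)) : BoundedBy ω r s C (∑ i ∈ t, G i) := by
  classical
  induction t using Finset.induction_on with
  | empty => simpa using BoundedBy.zero.mono_const hC
  | insert a t ha ih =>
    rw [Finset.sum_insert ha]
    exact (h _ (Finset.mem_insert_self _ _)).add hr hs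
      (ih fun i hi => h i (Finset.mem_insert_of_mem hi))

end Ultra

/-- The derivative `∂/∂xⱼ` of the coefficients. -/
def dX (j : Fin N) : FormalSums K N M →ₗ[K] FormalSums K N M :=
  LinearMap.compLeft (MvPowerSeries.pderiv K j).toLinearMap M

@[simp] theorem dX_apply (j : Fin N) (g : FormalSums K N M) (m : M) :
    dX j g m = MvPowerSeries.pderiv K j (g m) := rfl

theorem pderiv_comm (j k : Fin N) (f : MvPowerSeries (Fin N) K) :
    MvPowerSeries.pderiv K j (MvPowerSeries.pderiv K k f) =
      MvPowerSeries.pderiv K k (MvPowerSeries.pderiv K j f) := by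
  ext u
  simp only [MvPowerSeries.coeff_pderiv, Finsupp.add_apply]
  rcases eq_or_ne j k with rfl | h
  · rfl
  · rw [Finsupp.single_eq_of_ne h, Finsupp.single_eq_of_ne h.symm,
      add_right_comm]
    push_cast
    ring

/-! ### Multiplication by monomials and the operators `∇ⱼ` -/

variable [AddCommMonoid M] [IsCancelAdd M]

/-- Multiplication by `Tᵉ`, that is, `∑ₘ gₘ Tᵐ ↦ ∑ₘ gₘ Tᵉ⁺ᵐ`: the coefficient at `e + m` is `gₘ`,
and the coefficients at the indices outside `e + M` are zero. -/
def shift (e : M) : FormalSums K N M →ₗ[MvPowerSeries (Fin N) K] FormalSums K N M where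
  toFun g := Function.extend (fun m => e + m) g 0
  map_add' g g' := by
    simpa using Function.extend_add (fun m => e + m) g g' 0 0
  map_smul' a g := by
    ext1 m
    by_cases h : ∃ m', e + m' = m
    · obtain ⟨m', rfl⟩ := h
      have := add_right_injective e
      simp [this.extend_apply]
    · simp [Function.extend_apply' _ _ _ h]

theorem shift_add_apply (e m : M) (g : FormalSums K N M) : shift e g (e + m) = g m :=
  (add_right_injective e).extend_apply _ _ _

theorem shift_apply_of_not {e m : M} (h : ¬ ∃ m', e + m' = m) (g : FormalSums K N M) :
    shift e g m = 0 :=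
  Function.extend_apply' _ _ _ h

theorem shift_shift (e e' : M) (g : FormalSums K N M) :
    shift e (shift e' g) = shift (e + e') g := by
  ext1 m
  by_cases h : ∃ m', e + m' = m
  · obtain ⟨m, rfl⟩ := h
    rw [shift_add_apply]
    by_cases h : ∃ m', e' + m' = m
    · obtain ⟨m, rfl⟩ := h
      rw [← add_assoc, shift_add_apply, shift_add_apply]
    · rw [shift_apply_of_not h, shift_apply_of_not]
      rintro ⟨m', hm'⟩
      exact h ⟨m', by rw [add_assoc] at hm'; exact add_left_cancel hm'⟩
  · rw [shift_apply_of_not h, shift_apply_of_not]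
    rintro ⟨m', rfl⟩
    exact h ⟨e' + m', (add_assoc _ _ _).symm⟩

theorem dX_shift (j : Fin N) (e : M) (g : FormalSums K N M) :
    dX j (shift e g) = shift e (dX j g) := by
  ext1 m
  by_cases h : ∃ m', e + m' = m
  · obtain ⟨m, rfl⟩ := h
    simp [shift_add_apply]
  · simp [shift_apply_of_not h]

/-- The operator `∇ⱼ = ∂/∂xⱼ + π T^{eⱼ}`. -/
def nabla (ϖ : K) (e : Fin N → M) (j : Fin N) : Module.End K (FormalSums K N M) :=
  dX j + ϖ • (shift (e j)).restrictScalars K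

/-- The operator `π⁻¹ ∇ⱼ`. -/
def delta (ϖ : K) (e : Fin N → M) (j : Fin N) : Module.End K (FormalSums K N M) :=
  ϖ⁻¹ • nabla ϖ e j

/-- The operator `∇ᵛ / π^{|v|} = ∏ⱼ (π⁻¹ ∇ⱼ) ^ vⱼ` (the factors commute). -/
def deltaPow (ϖ : K) (e : Fin N → M) (v : Fin N →₀ ℕ) : Module.End K (FormalSums K N M) :=
  ((List.finRange N).map fun j => delta ϖ e j ^ v j).prod

/-- The action of the formal operator `∑ᵥ fᵥ ∂ᵛ / π^{|v|}` on `g`, where `∂ⱼ` acts as `∇ⱼ`: the sum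
`∑ᵥ fᵥ ∇ᵛ(g) / π^{|v|}`, which converges coefficient by coefficient. -/
def act (ϖ : K) (e : Fin N → M) (f : FormalSums K N (Fin N →₀ ℕ)) (g : FormalSums K N M) :
    FormalSums K N M :=
  ∑' v : Fin N →₀ ℕ, f v • deltaPow ϖ e v g

theorem delta_apply {ϖ : K} {e : Fin N → M} (hϖ : ϖ ≠ 0) (j : Fin N) (g : FormalSums K N M) :
    delta ϖ e j g = ϖ⁻¹ • dX j g + shift (e j) g := by
  simp [delta, nabla, smul_smul, hϖ]

theorem const_smul_eq_C_smul (a : K) (g : FormalSums K N M) :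
    a • g = (MvPowerSeries.C a : MvPowerSeries (Fin N) K) • g := by
  ext1 m
  simp [MvPowerSeries.smul_eq_C_mul]

theorem dX_smul (j : Fin N) (a : MvPowerSeries (Fin N) K) (g : FormalSums K N M) :
    dX j (a • g) = MvPowerSeries.pderiv K j a • g + a • dX j g := by
  ext1 m
  simp [mul_comm, add_comm]

theorem continuous_pderiv (j : Fin N) :
    Continuous (MvPowerSeries.pderiv K j : MvPowerSeries (Fin N) K → MvPowerSeries (Fin N) K) := by
  refine continuous_pi fun u => ?_
  have : (fun f : MvPowerSeries (Fin N) K => (MvPowerSeries.pderiv K j f) u) =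
      fun f => MvPowerSeries.coeff (u + Finsupp.single j 1) f * ((u j : K) + 1) := by
    ext1 f
    exact MvPowerSeries.coeff_pderiv f u
  rw [this]
  exact (MvPowerSeries.WithPiTopology.continuous_coeff K _).mul continuous_const

theorem continuous_dX (j : Fin N) :
    Continuous (dX j : FormalSums K N M → FormalSums K N M) :=
  continuous_pi fun m => (continuous_pderiv j).comp (continuous_apply m)

theorem continuous_shift (e : M) : Continuous (shift e : FormalSums K N M → FormalSums K N M) := by
  refine continuous_pi fun m => ?_
  by_cases h : ∃ m', e + m' = m
  · obtain ⟨m, rfl⟩ := h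
    simp only [shift_add_apply]
    exact continuous_apply m
  · simp only [shift_apply_of_not h]
    exact continuous_const

theorem continuous_K_smul (a : K) : Continuous fun g : FormalSums K N M => a • g := by
  simp only [const_smul_eq_C_smul]
  exact continuous_const_smul _

theorem continuous_delta {ϖ : K} {e : Fin N → M} (hϖ : ϖ ≠ 0) (j : Fin N) :
    Continuous (delta ϖ e j : FormalSums K N M → FormalSums K N M) := by
  have : (delta ϖ e j : FormalSums K N M → FormalSums K N M) =
      fun g => ϖ⁻¹ • dX j g + shift (e j) g := by
    ext1 g
    exact delta_apply hϖ j g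
  rw [this]
  exact ((continuous_K_smul _).comp (continuous_dX j)).add (continuous_shift _)

theorem delta_commute (ϖ : K) (e : Fin N → M) (j k : Fin N) :
    Commute (delta ϖ e j) (delta ϖ e k) := by
  refine Commute.smul_left (Commute.smul_right ?_ _) _
  ext1 g
  simp only [nabla, Module.End.mul_apply, LinearMap.add_apply, LinearMap.smul_apply, map_add,
    LinearMap.restrictScalars_apply, map_smul, dX_shift, shift_shift]
  have h1 : dX j (dX k g) = dX k (dX j g) := by
    ext1 m
    simp [pderiv_comm]
  rw [h1, add_comm (e j) (e k)]
  module

theorem list_prod_pow_add {E : Type*} [Monoid E] {ι : Type*} (d : ι → E)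
    (hd : ∀ i j, Commute (d i) (d j)) (l : List ι) (v w : ι → ℕ) :
    (l.map fun j => d j ^ (v j + w j)).prod =
      (l.map fun j => d j ^ v j).prod * (l.map fun j => d j ^ w j).prod := by
  induction l with
  | nil => simp
  | cons a l ih =>
    have : Commute (d a ^ w a) (l.map fun j => d j ^ v j).prod := by
      apply Commute.list_prod_right
      intro x hx
      obtain ⟨j, -, rfl⟩ := List.mem_map.1 hx
      exact (hd a j).pow_pow _ _
    rw [List.map_cons, List.map_cons, List.map_cons, List.prod_cons, List.prod_cons,
      List.prod_cons, ih, pow_add]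
    calc _ = d a ^ v a * (d a ^ w a * (l.map fun j => d j ^ v j).prod) *
          (l.map fun j => d j ^ w j).prod := by simp only [mul_assoc]
      _ = _ := by rw [this.eq]; simp only [mul_assoc]

theorem deltaPow_add (ϖ : K) (e : Fin N → M) (v w : Fin N →₀ ℕ) :
    deltaPow ϖ e (v + w) = deltaPow ϖ e v * deltaPow ϖ e w :=
  list_prod_pow_add _ (delta_commute ϖ e) _ _ _

theorem deltaPow_zero (ϖ : K) (e : Fin N → M) : deltaPow ϖ e 0 = 1 := by
  simp [deltaPow]

theorem deltaPow_single (ϖ : K) (e : Fin N → M) (j : Fin N) :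
    deltaPow ϖ e (Finsupp.single j 1) = delta ϖ e j := by
  classical
  rw [deltaPow, List.prod_map_eq_pow_single j _ fun i hi _ => by
    rw [Finsupp.single_eq_of_ne hi, pow_zero]]
  simp [List.count_eq_one_of_mem (List.nodup_finRange N) (List.mem_finRange j)]

end General

/-! ### Convergence -/

section Estimates

variable {K : Type*} [NormedField K] {N : ℕ} {M : Type*}

/-- The numbers `|k! / πᵏ|` grow at most linearly. -/
def FactorialBound (ϖ : K) : Prop :=
  ϖ ≠ 0 ∧ ∃ B : ℝ, ∀ k : ℕ, ‖(k.factorial : K)‖ ≤ B * (k + 1) * ‖ϖ‖ ^ k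

theorem norm_natCast_of_padic (p : ℕ) [Fact p.Prime] [NormedAlgebra ℚ_[p] K] (k : ℕ) :
    ‖(k : K)‖ = ‖(k : ℚ_[p])‖ := by
  rw [← map_natCast (algebraMap ℚ_[p] K) k, norm_algebraMap']

theorem DworkPi.factorialBound {p : ℕ} [Fact p.Prime] [NormedAlgebra ℚ_[p] K]
    (ϖ : DworkPi p K) : FactorialBound (ϖ : K) := by
  have hp : p.Prime := Fact.out
  have hp1 : p - 1 ≠ 0 := by have := hp.two_le; omega
  have hp0 : (0 : ℝ) < p := by exact_mod_cast hp.pos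
  have hn : ‖(ϖ : K)‖ ^ (p - 1) = (p : ℝ)⁻¹ := by
    rw [← norm_pow, eq_neg_of_add_eq_zero_left ϖ.2, norm_neg, norm_natCast_of_padic p,
      Padic.norm_p]
  refine ⟨?_, p, fun k => ?_⟩
  · intro h
    rw [h, norm_zero, zero_pow hp1] at hn
    exact hp0.ne (inv_eq_zero.1 hn.symm).symm
  rcases eq_or_ne k 0 with rfl | hk
  · simpa using hp.one_le
  refine le_of_pow_le_pow_left₀ hp1 (by positivity) ?_
  have h1 : ‖(k.factorial : K)‖ = (p : ℝ) ^ (-(padicValNat p k.factorial : ℤ)) := by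
    rw [norm_natCast_of_padic p, Padic.norm_eq_zpow_neg_valuation
      (by exact_mod_cast k.factorial_ne_zero), Padic.valuation_natCast]
  have h2 : (p - 1) * padicValNat p k.factorial + (p.digits k).sum = k := by
    rw [sub_one_mul_padicValNat_factorial, Nat.sub_add_cancel (Nat.digit_sum_le p k)]
  have h3 : (p.digits k).sum ≤ (p.digits k).length * (p - 1) := by
    have := List.sum_le_card_nsmul (p.digits k) (p - 1) fun d hd => by
      have := Nat.digits_lt_base hp.one_lt hd
      omega
    simpa using this
  have h4 : p ^ (p.digits k).length ≤ p * k := Nat.base_pow_length_digits_le p k hp.one_lt hk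
  rw [h1, mul_pow, ← pow_mul, mul_comm k, pow_mul, hn]
  have h5 : ((p : ℝ) ^ (-(padicValNat p k.factorial : ℤ))) ^ (p - 1) =
      (p : ℝ) ^ (p.digits k).sum * (p : ℝ)⁻¹ ^ k := by
    rw [zpow_neg, zpow_natCast, ← inv_pow, ← pow_mul, mul_comm]
    have h6 : (p : ℝ)⁻¹ ^ k = (p : ℝ)⁻¹ ^ ((p - 1) * padicValNat p k.factorial) *
        (p : ℝ)⁻¹ ^ (p.digits k).sum := by
      rw [← pow_add, h2]
    rw [h6, mul_left_comm, ← mul_pow, mul_inv_cancel₀ hp0.ne', one_pow, mul_one]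
  rw [h5]
  gcongr
  calc (p : ℝ) ^ (p.digits k).sum ≤ (p : ℝ) ^ ((p.digits k).length * (p - 1)) := by
        gcongr
        exact_mod_cast hp.one_le
    _ = ((p : ℝ) ^ (p.digits k).length) ^ (p - 1) := pow_mul _ _ _
    _ ≤ (p * (k + 1)) ^ (p - 1) := by
        gcongr
        calc ((p : ℝ) ^ (p.digits k).length) ≤ p * k := by exact_mod_cast h4
          _ ≤ _ := by gcongr; linarith

theorem coeff_dX_pow (j : Fin N) (k : ℕ) (g : FormalSums K N M) (m : M) (u : Fin N →₀ ℕ) :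
    MvPowerSeries.coeff u ((dX j ^ k : Module.End K (FormalSums K N M)) g m) =
      MvPowerSeries.coeff (u + Finsupp.single j k) (g m) *
        ((k.factorial : K) * ((u j + k).choose k : K)) := by
  have key : MvPowerSeries.coeff u ((dX j ^ k : Module.End K (FormalSums K N M)) g m) =
      MvPowerSeries.coeff (u + Finsupp.single j k) (g m) * ((u j + 1).ascFactorial k : K) := by
    induction k generalizing u with
    | zero => simp
    | succ k ih =>
      rw [pow_succ', Module.End.mul_apply, dX_apply, MvPowerSeries.coeff_pderiv, ih, add_assoc,
        ← Finsupp.single_add, add_comm 1 k, Nat.ascFactorial_succ, mul_assoc]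
      congr 1
      have : (u j + 1) * (u j + 1 + 1).ascFactorial k = (u j + 1 + k) * (u j + 1).ascFactorial k := by
        have := Nat.succ_ascFactorial (u j + 1) k
        simpa using this
      have h := congrArg (Nat.cast : ℕ → K) this
      push_cast at h ⊢
      rw [Pi.add_apply, Finsupp.single_eq_same, ← h]
      ring
  rw [key, Nat.ascFactorial_eq_factorial_mul_choose]
  push_cast
  rfl

theorem exists_linear_le_pow {s : ℝ} (hs : 1 < s) :
    ∃ B : ℝ, 0 ≤ B ∧ ∀ k : ℕ, (k + 1 : ℝ) ≤ B * s ^ k := by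
  refine ⟨max 1 (s - 1)⁻¹, by positivity, fun k => ?_⟩
  have h := one_add_mul_le_pow (a := s - 1) (by linarith : (-2 : ℝ) ≤ s - 1) k
  have h0 : 0 < s - 1 := by linarith
  have h1 : (k : ℝ) * (s - 1) + 1 ≤ s ^ k := by
    rw [add_sub_cancel] at h
    linarith
  have h2 : (1 : ℝ) ≤ max 1 (s - 1)⁻¹ * 1 := by simp
  have h3 : (1 : ℝ) ≤ max 1 (s - 1)⁻¹ * (s - 1) := by
    calc (1 : ℝ) = (s - 1)⁻¹ * (s - 1) := (inv_mul_cancel₀ h0.ne').symm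
      _ ≤ _ := by
        gcongr
        exact le_max_right _ _
  calc (k + 1 : ℝ) ≤ k * (max 1 (s - 1)⁻¹ * (s - 1)) + max 1 (s - 1)⁻¹ * 1 := by
        gcongr
        exact le_mul_of_one_le_right (by positivity) h3
    _ = max 1 (s - 1)⁻¹ * (k * (s - 1) + 1) := by ring
    _ ≤ _ := by gcongr

variable [IsUltrametricDist K]

theorem BoundedBy.dX_pow {ω : M → ℝ} {r s C : ℝ} (hr : 1 ≤ r) (hs : 1 ≤ s)
    {g : FormalSums K N M} (h : BoundedBy ω r s C g) (j : Fin N) (k : ℕ) :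
    BoundedBy ω r s (‖(k.factorial : K)‖ * C) ((dX j ^ k : Module.End K (FormalSums K N M)) g) := by
  intro m u
  have h1 := h m (u + Finsupp.single j k)
  rw [coeff_dX_pow, norm_mul, norm_mul]
  have h2 : ‖((u j + k).choose k : K)‖ ≤ 1 := IsUltrametricDist.norm_natCast_le_one K _
  have h3 : r ^ u.degree ≤ r ^ (u + Finsupp.single j k).degree := by
    gcongr
    simp
  calc _ ≤ ‖MvPowerSeries.coeff (u + Finsupp.single j k) (g m)‖ * (‖(k.factorial : K)‖ * 1) *
        r ^ (u + Finsupp.single j k).degree * s ^ ω m := by gcongr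
    _ = ‖(k.factorial : K)‖ * (‖MvPowerSeries.coeff (u + Finsupp.single j k) (g m)‖ *
        r ^ (u + Finsupp.single j k).degree * s ^ ω m) := by ring
    _ ≤ _ := by gcongr

theorem BoundedBy.dX {ω : M → ℝ} {r s C : ℝ} (hr : 1 ≤ r) (hs : 1 ≤ s)
    {g : FormalSums K N M} (h : BoundedBy ω r s C g) (j : Fin N) :
    BoundedBy ω r s C (dX j g) := by
  simpa using h.dX_pow hr hs j 1

/-- Multiplication by a power series. -/
theorem BoundedBy.smul {ω : M → ℝ} {r s C C' : ℝ} (hr : 0 < r) (hs : 0 < s) (hC' : 0 ≤ C')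
    {g : FormalSums K N M} (h : BoundedBy ω r s C g) {f : MvPowerSeries (Fin N) K}
    (hf : ∀ u : Fin N →₀ ℕ, ‖MvPowerSeries.coeff u f‖ * r ^ u.degree ≤ C') :
    BoundedBy ω r s (C' * C) (f • g) := by
  classical
  intro m
  have hC : 0 ≤ C := by
    have : Nonempty M := ⟨m⟩
    exact h.nonneg hr.le hs.le
  revert m
  rw [← BoundedBy, boundedBy_iff hr hs]
  intro m u
  rw [Pi.smul_apply, smul_eq_mul, MvPowerSeries.coeff_mul]
  refine IsUltrametricDist.norm_sum_le_of_forall_le_of_nonneg (by positivity) fun x hx => ?_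
  rw [Finset.HasAntidiagonal.mem_antidiagonal] at hx
  rw [le_div_iff₀ (by positivity), norm_mul]
  calc _ = (‖MvPowerSeries.coeff x.1 f‖ * r ^ x.1.degree) *
        (‖MvPowerSeries.coeff x.2 (g m)‖ * r ^ x.2.degree * s ^ ω m) := by
        rw [← hx, map_add, pow_add]
        ring
    _ ≤ _ := mul_le_mul (hf _) (h _ _) (by positivity) hC'

variable [AddCommMonoid M] [IsCancelAdd M]

theorem BoundedBy.shift {ω : M → ℝ} {e : M} (hω : ∀ m, ω (e + m) ≤ ω m + 1) {r s C : ℝ}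
    (hr : 0 < r) (hs : 1 ≤ s) {g : FormalSums K N M} (h : BoundedBy ω r s C g) :
    BoundedBy ω r s (s * C) (shift e g) := by
  have hs0 : 0 < s := by linarith
  intro m u
  by_cases hm : ∃ m', e + m' = m
  · obtain ⟨m, rfl⟩ := hm
    rw [shift_add_apply]
    calc _ ≤ ‖MvPowerSeries.coeff u (g m)‖ * r ^ u.degree * s ^ (ω m + 1) := by
          gcongr
          exact hω m
      _ = s * (‖MvPowerSeries.coeff u (g m)‖ * r ^ u.degree * s ^ ω m) := by
          rw [Real.rpow_add hs0, Real.rpow_one]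
          ring
      _ ≤ _ := by gcongr; exact h m u
  · rw [shift_apply_of_not hm]
    have : 0 ≤ C := by
      have : Nonempty M := ⟨m⟩
      exact h.nonneg hr.le hs0.le
    simp only [map_zero, norm_zero, zero_mul]
    positivity

theorem BoundedBy.shift_pow {ω : M → ℝ} {e : M} (hω : ∀ m, ω (e + m) ≤ ω m + 1) {r s C : ℝ}
    (hr : 0 < r) (hs : 1 ≤ s) {g : FormalSums K N M} (h : BoundedBy ω r s C g) (k : ℕ) :
    BoundedBy ω r s (s ^ k * C)
      (((GKZ.shift e).restrictScalars K ^ k : Module.End K (FormalSums K N M)) g) := by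
  induction k with
  | zero => simpa using h
  | succ k ih =>
    rw [pow_succ', pow_succ', Module.End.mul_apply, mul_assoc]
    exact ih.shift hω hr hs

theorem exists_delta_bound {ϖ : K} (hϖ : FactorialBound ϖ) {ω : M → ℝ} {e : Fin N → M}
    (hω : ∀ j m, ω (e j + m) ≤ ω m + 1) {r s : ℝ} (hr : 1 < r) (hs : 1 < s) :
    ∃ B : ℝ, 0 ≤ B ∧ ∀ (j : Fin N) (k : ℕ) (C : ℝ) (g : FormalSums K N M), BoundedBy ω r s C g →
      BoundedBy ω r s (B * s ^ k * C) ((delta ϖ e j ^ k) g) := by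
  obtain ⟨h0, B, hB⟩ := hϖ
  obtain ⟨B', hB', h'⟩ := exists_linear_le_pow hs
  have hBn : 0 ≤ B := by simpa using (norm_nonneg _).trans (hB 0)
  have hϖ0 : 0 < ‖ϖ‖ := norm_pos_iff.2 h0
  refine ⟨B * B', by positivity, fun j k C g hg => ?_⟩
  intro m
  have hC : 0 ≤ C := by
    have : Nonempty M := ⟨m⟩
    exact hg.nonneg (by linarith) (by linarith)
  revert m
  rw [← BoundedBy]
  have hd : delta ϖ e j = ϖ⁻¹ • dX j + (shift (e j)).restrictScalars K := by
    rw [delta, nabla, smul_add, smul_smul, inv_mul_cancel₀ h0, one_smul]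
  have hc : Commute (ϖ⁻¹ • dX j : Module.End K (FormalSums K N M))
      ((shift (e j)).restrictScalars K) := by
    refine Commute.smul_left ?_ _
    ext1 g
    exact dX_shift _ _ _
  rw [hd, hc.add_pow, LinearMap.sum_apply]
  refine BoundedBy.sum (by positivity) (by linarith) (by linarith) _ _ fun i hi => ?_
  have hik : i ≤ k := by
    have := Finset.mem_range.1 hi
    omega
  rw [← nsmul_eq_mul', LinearMap.smul_apply, ← Nat.cast_smul_eq_nsmul K, Module.End.mul_apply,
    smul_pow, LinearMap.smul_apply]
  refine (((((hg.shift_pow (hω j) (by linarith) hs.le (k - i)).dX_pow hr.le hs.le j i).const_smul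
    (ϖ⁻¹ ^ i)).const_smul _).mono_const ?_)
  have h1 : ‖((k.choose i : ℕ) : K)‖ ≤ 1 := IsUltrametricDist.norm_natCast_le_one K _
  calc _ ≤ 1 * (‖ϖ⁻¹ ^ i‖ * ((B * (i + 1) * ‖ϖ‖ ^ i) * (s ^ (k - i) * C))) := by
        gcongr
        exact hB i
    _ = B * (i + 1) * (s ^ (k - i) * C) := by
        rw [norm_pow, norm_inv, inv_pow]
        field_simp
    _ ≤ B * (B' * s ^ i) * (s ^ (k - i) * C) := by
        gcongr
        exact h' i
    _ = B * B' * (s ^ i * s ^ (k - i)) * C := by ring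
    _ = _ := by rw [← pow_add, Nat.add_sub_cancel' hik]

theorem exists_deltaPow_bound {ϖ : K} (hϖ : FactorialBound ϖ) {ω : M → ℝ} {e : Fin N → M}
    (hω : ∀ j m, ω (e j + m) ≤ ω m + 1) {r s : ℝ} (hr : 1 < r) (hs : 1 < s) :
    ∃ B : ℝ, 0 ≤ B ∧ ∀ (v : Fin N →₀ ℕ) (C : ℝ) (g : FormalSums K N M), BoundedBy ω r s C g →
      BoundedBy ω r s (B * s ^ v.degree * C) (deltaPow ϖ e v g) := by
  obtain ⟨B, hB, h⟩ := exists_delta_bound hϖ hω hr hs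
  refine ⟨B ^ N, by positivity, fun v C g hg => ?_⟩
  have key : ∀ l : List (Fin N), BoundedBy ω r s (B ^ l.length * s ^ (l.map v).sum * C)
      ((l.map fun j => delta ϖ e j ^ v j).prod g) := by
    intro l
    induction l with
    | nil => simpa using hg
    | cons a l ih =>
      rw [List.map_cons, List.map_cons, List.prod_cons, Module.End.mul_apply]
      refine (h _ _ _ _ ih).mono_const (le_of_eq ?_)
      rw [List.length_cons, List.sum_cons, pow_succ, pow_add]
      ring
  have := key (List.finRange N)
  rwa [List.length_finRange, ← List.ofFn_eq_map, List.sum_ofFn, ← Finsupp.degree_eq_sum] at this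

theorem IsOverconvergent.dX (j : Fin N)
    {ω : M → ℝ} {g : FormalSums K N M}
    (hg : IsOverconvergent ω g) : IsOverconvergent ω (dX j g) := by
  obtain ⟨r, hr, s, hs, C, h⟩ := hg
  exact ⟨r, hr, s, hs, C, h.dX hr.le hs.le j⟩

theorem IsOverconvergent.const_smul (a : K) {ω : M → ℝ} {g : FormalSums K N M}
    (hg : IsOverconvergent ω g) :
    IsOverconvergent ω (a • g) := by
  obtain ⟨r, hr, s, hs, C, h⟩ := hg
  exact ⟨r, hr, s, hs, _, h.const_smul a⟩

theorem IsOverconvergent.shift {ω : M → ℝ} {g : FormalSums K N M} {e : M}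
    (hω : ∀ m, ω (e + m) ≤ ω m + 1) (hg : IsOverconvergent ω g) : IsOverconvergent ω (shift e g) := by
  obtain ⟨r, hr, s, hs, C, h⟩ := hg
  exact ⟨r, hr, s, hs, _, BoundedBy.shift hω (by linarith) hs.le h⟩

end Estimates
section Action

variable {K : Type*} [NormedField K] [IsUltrametricDist K] [CompleteSpace K]
  {N : ℕ} {M : Type*}

theorem tendsto_geometric {q : ℝ} (hq0 : 0 ≤ q) (hq : q < 1) (C : ℝ) :
    Filter.Tendsto (fun v : Fin N →₀ ℕ => C * q ^ v.degree) Filter.cofinite (nhds 0) := by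
  have h : Filter.Tendsto (fun v : Fin N →₀ ℕ => v.degree) Filter.cofinite Filter.atTop := by
    rw [Filter.tendsto_atTop]
    intro b
    rw [Filter.eventually_cofinite]
    simpa using Finsupp.finite_of_degree_lt b
  simpa using ((tendsto_pow_atTop_nhds_zero_of_lt_one hq0 hq).comp h).const_mul C

theorem tendsto_geometric_prod {q q' : ℝ} (hq0 : 0 ≤ q) (hq : q < 1) (hq0' : 0 ≤ q')
    (hq' : q' < 1) (C : ℝ) :
    Filter.Tendsto (fun x : (Fin N →₀ ℕ) × (Fin N →₀ ℕ) => C * q ^ x.1.degree * q' ^ x.2.degree)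
      Filter.cofinite (nhds 0) := by
  have h : Filter.Tendsto (fun x : (Fin N →₀ ℕ) × (Fin N →₀ ℕ) => x.1.degree + x.2.degree)
      Filter.cofinite Filter.atTop := by
    rw [Filter.tendsto_atTop]
    intro b
    rw [Filter.eventually_cofinite]
    refine Set.Finite.subset ((Finsupp.finite_of_degree_lt b).prod (Finsupp.finite_of_degree_lt b))
      fun x hx => ?_
    simp only [Set.mem_ofPred_eq, not_le] at hx
    exact ⟨by simp only [Set.mem_ofPred_eq]; omega, by simp only [Set.mem_ofPred_eq]; omega⟩
  have h0 : 0 ≤ max q q' := le_max_of_le_left hq0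
  have := ((tendsto_pow_atTop_nhds_zero_of_lt_one h0 (max_lt hq hq')).comp h).const_mul |C|
  rw [mul_zero] at this
  refine squeeze_zero_norm (fun x => ?_) this
  rw [norm_mul, norm_mul, mul_assoc, Real.norm_eq_abs C, norm_pow, norm_pow,
    Real.norm_of_nonneg hq0, Real.norm_of_nonneg hq0', Function.comp_apply, pow_add]
  gcongr
  · exact le_max_left _ _
  · exact le_max_right _ _

theorem summable_of_boundedBy {ι : Type*} {ω : M → ℝ} (hω : ∀ m, 0 ≤ ω m) {r s : ℝ} (hr : 1 ≤ r)
    (hs : 1 ≤ s) {G : ι → FormalSums K N M} {c : ι → ℝ} (h : ∀ i, BoundedBy ω r s (c i) (G i))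
    (hc : Filter.Tendsto c Filter.cofinite (nhds 0)) : Summable G := by
  refine Pi.summable.2 fun m => ?_
  rw [MvPowerSeries.WithPiTopology.summable_iff_summable_coeff]
  intro u
  refine NonarchimedeanAddGroup.summable_of_tendsto_cofinite_zero ?_
  refine squeeze_zero_norm (fun i => ?_) hc
  refine le_trans ?_ (h i m u)
  rw [mul_assoc]
  refine le_mul_of_one_le_right (norm_nonneg _) ?_
  exact one_le_mul_of_one_le_of_one_le (one_le_pow₀ hr) (Real.one_le_rpow hs (hω m))

theorem boundedBy_tsum {ι : Type*} {ω : M → ℝ} {r s C : ℝ} (hC : 0 ≤ C) (hr : 0 < r)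
    (hs : 0 < s) {G : ι → FormalSums K N M} (h : ∀ i, BoundedBy ω r s C (G i)) (hG : Summable G) :
    BoundedBy ω r s C (∑' i, G i) := by
  rw [boundedBy_iff hr hs]
  intro m u
  have h1 := (MvPowerSeries.WithPiTopology.hasSum_iff_hasSum_coeff.1
    ((Pi.hasSum.1 hG.hasSum) m)) u
  rw [← h1.tsum_eq]
  exact IsUltrametricDist.norm_tsum_le_of_forall_le_of_nonneg (by positivity)
    fun i => (boundedBy_iff hr hs).1 (h i) m u

/-- The total degree `|v|`. -/
def absDeg (v : Fin N →₀ ℕ) : ℝ := (v.degree : ℝ)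

theorem absDeg_nonneg (v : Fin N →₀ ℕ) : 0 ≤ absDeg v := Nat.cast_nonneg _

theorem absDeg_single_add (j : Fin N) (v : Fin N →₀ ℕ) :
    absDeg (Finsupp.single j 1 + v) ≤ absDeg v + 1 := by
  simp [absDeg, add_comm]

variable [AddCommMonoid M] [IsCancelAdd M]

/-- A nonnegative weight that increases by at most one under each shift. -/
structure IsWeight (ω : M → ℝ) (e : Fin N → M) : Prop where
  nonneg : ∀ m, 0 ≤ ω m
  step : ∀ j m, ω (e j + m) ≤ ω m + 1

theorem isWeight_absDeg : IsWeight absDeg (fun j : Fin N => Finsupp.single j 1) :=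
  ⟨absDeg_nonneg, absDeg_single_add⟩

/-- Common radii for an operator and the formal sum on which it acts. -/
theorem exists_term_bound {ϖ : K} (hϖ : FactorialBound ϖ) {ω : M → ℝ} {e : Fin N → M}
    (hω : IsWeight ω e) {f : FormalSums K N (Fin N →₀ ℕ)} (hf : IsOverconvergent absDeg f) {g : FormalSums K N M} (hg : IsOverconvergent ω g) :
    ∃ r > 1, ∃ s > 1, ∃ C, 0 ≤ C ∧ ∃ q, 0 ≤ q ∧ q < 1 ∧
      ∀ v, BoundedBy ω r s (C * q ^ v.degree) (f v • deltaPow ϖ e v g) := by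
  obtain ⟨r, hr, s, hs, C, hf⟩ := hf
  obtain ⟨r', hr', s', hs', C', hg⟩ := hg
  have h1 : (1 : ℝ) < min r r' := lt_min hr hr'
  obtain ⟨σ, hσ, hσ'⟩ := exists_between (lt_min hs hs')
  have hσs : σ < s := hσ'.trans_le (min_le_left _ _)
  have hf := hf.mono (r' := min r r') (s' := s) absDeg_nonneg (by positivity) (by positivity)
    (min_le_left _ _) le_rfl
  have hg := hg.mono (r' := min r r') (s' := σ) hω.nonneg (by positivity) (by positivity)
    (min_le_right _ _) (hσ'.le.trans (min_le_right _ _))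
  obtain ⟨B, hB, h⟩ := exists_deltaPow_bound hϖ hω.step h1 hσ (e := e)
  have hC : 0 ≤ C := hf.nonneg (by positivity) (by positivity)
  have hs0 : 0 < s := by linarith
  have hg := hg.mono_const (le_max_right 0 C')
  have hC' : 0 ≤ max 0 C' := le_max_left _ _
  refine ⟨_, h1, σ, hσ, C * (B * max 0 C'), by positivity, σ / s, by positivity,
    (div_lt_one hs0).2 hσs, fun v => ?_⟩
  refine (BoundedBy.smul (C' := C / s ^ v.degree) (by positivity) (by positivity) (by positivity)
    (h v _ _ hg) fun u => ?_).mono_const (le_of_eq ?_)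
  · rw [le_div_iff₀ (by positivity)]
    have := hf v u
    rwa [absDeg, Real.rpow_natCast] at this
  · rw [div_pow]
    ring

section Act

variable {ϖ : K} {ω : M → ℝ} {e : Fin N → M} {f f' : FormalSums K N (Fin N →₀ ℕ)}
  {g g' : FormalSums K N M}

theorem summable_act (hϖ : FactorialBound ϖ) (hω : IsWeight ω e) (hf : IsOverconvergent absDeg f)
    (hg : IsOverconvergent ω g) : Summable fun v => f v • deltaPow ϖ e v g := by
  obtain ⟨r, hr, s, hs, C, -, q, hq0, hq, h⟩ := exists_term_bound hϖ hω hf hg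
  exact summable_of_boundedBy hω.nonneg hr.le hs.le h (tendsto_geometric hq0 hq C)

theorem IsOverconvergent.act (hϖ : FactorialBound ϖ) (hω : IsWeight ω e)
    (hf : IsOverconvergent absDeg f) (hg : IsOverconvergent ω g) :
    IsOverconvergent ω (act ϖ e f g) := by
  obtain ⟨r, hr, s, hs, C, hC, q, hq0, hq, h⟩ := exists_term_bound hϖ hω hf hg
  refine ⟨r, hr, s, hs, C, boundedBy_tsum hC (by linarith) (by linarith) (fun v => ?_)
    (summable_act hϖ hω hf hg)⟩
  refine (h v).mono_const ?_
  exact mul_le_of_le_one_right hC (pow_le_one₀ hq0 hq.le)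

theorem act_add_left (hϖ : FactorialBound ϖ) (hω : IsWeight ω e)
    (hf : IsOverconvergent absDeg f) (hf' : IsOverconvergent absDeg f')
    (hg : IsOverconvergent ω g) : act ϖ e (f + f') g = act ϖ e f g + act ϖ e f' g := by
  rw [act, act, act, ← (summable_act hϖ hω hf hg).tsum_add (summable_act hϖ hω hf' hg)]
  simp only [Pi.add_apply, add_smul]

theorem act_add_right (hϖ : FactorialBound ϖ) (hω : IsWeight ω e)
    (hf : IsOverconvergent absDeg f) (hg : IsOverconvergent ω g)
    (hg' : IsOverconvergent ω g') : act ϖ e f (g + g') = act ϖ e f g + act ϖ e f g' := by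
  rw [act, act, act, ← (summable_act hϖ hω hf hg).tsum_add (summable_act hϖ hω hf hg')]
  simp only [map_add, smul_add]

theorem act_zero_left : act ϖ e 0 g = 0 := by
  simp [act]

theorem act_zero_right : act ϖ e f (0 : FormalSums K N M) = 0 := by
  simp [act]

theorem act_single (v : Fin N →₀ ℕ) (a : MvPowerSeries (Fin N) K) :
    act ϖ e (Pi.single v a) g = a • deltaPow ϖ e v g := by
  rw [act, tsum_eq_single v]
  · simp
  · intro w hw
    simp [Pi.single_eq_of_ne hw]

theorem IsOverconvergent.delta (hϖ : FactorialBound ϖ) (hω : IsWeight ω e) (j : Fin N)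
    (hg : IsOverconvergent ω g) : IsOverconvergent ω (delta ϖ e j g) := by
  obtain ⟨r, hr, s, hs, C, h⟩ := hg
  obtain ⟨B, -, hB⟩ := exists_delta_bound hϖ hω.step hr hs
  refine ⟨r, hr, s, hs, B * s ^ 1 * C, ?_⟩
  simpa using hB j 1 C g h

/-- Left multiplication of an operator by `π⁻¹ ∂ⱼ` acts as `π⁻¹ ∇ⱼ`. -/
theorem act_delta (hϖ : FactorialBound ϖ) (hω : IsWeight ω e) (j : Fin N)
    (hf : IsOverconvergent absDeg f) (hg : IsOverconvergent ω g) :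
    act ϖ e (GKZ.delta ϖ (fun j => Finsupp.single j 1) j f) g = GKZ.delta ϖ e j (act ϖ e f g) := by
  have hf1 := (hf.dX j).const_smul ϖ⁻¹
  have hf2 := hf.shift (absDeg_single_add j)
  have hs := summable_act hϖ hω hf hg
  rw [delta_apply hϖ.1, act_add_left hϖ hω hf1 hf2 hg]
  have h2 : act ϖ e (GKZ.shift (Finsupp.single j 1) f) g =
      ∑' v, f v • GKZ.delta ϖ e j (deltaPow ϖ e v g) := by
    rw [act, ← tsum_extend_zero (add_right_injective (Finsupp.single j 1 : Fin N →₀ ℕ))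
      fun v => f v • GKZ.delta ϖ e j (deltaPow ϖ e v g)]
    refine tsum_congr fun v => ?_
    by_cases h : ∃ m', Finsupp.single j 1 + m' = v
    · obtain ⟨v, rfl⟩ := h
      rw [(add_right_injective (Finsupp.single j 1 : Fin N →₀ ℕ)).extend_apply, shift_add_apply,
        deltaPow_add, deltaPow_single, Module.End.mul_apply]
    · rw [Function.extend_apply' _ _ _ h, shift_apply_of_not h, zero_smul, Pi.zero_apply]
  have h3 : Summable fun v => f v • GKZ.delta ϖ e j (deltaPow ϖ e v g) := by
    have : (fun v => f v • GKZ.delta ϖ e j (deltaPow ϖ e v g)) =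
        fun v => f v • deltaPow ϖ e v (GKZ.delta ϖ e j g) := by
      ext1 v
      rw [← deltaPow_single, ← Module.End.mul_apply, ← Module.End.mul_apply, ← deltaPow_add,
        ← deltaPow_add, add_comm]
    rw [this]
    exact summable_act hϖ hω hf (hg.delta hϖ hω j)
  rw [h2, act, act, hs.map_tsum (GKZ.delta ϖ e j) (continuous_delta hϖ.1 j),
    ← (summable_act hϖ hω hf1 hg).tsum_add h3]
  refine tsum_congr fun v => ?_
  simp only [delta_apply hϖ.1, dX_smul, map_smul, Pi.smul_apply, dX_apply, smul_add]
  simp only [const_smul_eq_C_smul, MvPowerSeries.smul_eq_C_mul, smul_smul, mul_comm (f v)]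
  abel

theorem act_deltaPow (hϖ : FactorialBound ϖ) (hω : IsWeight ω e) (v : Fin N →₀ ℕ)
    (hf : IsOverconvergent absDeg f) (hg : IsOverconvergent ω g) :
    IsOverconvergent absDeg (deltaPow ϖ (fun j => Finsupp.single j 1) v f) ∧
    act ϖ e (deltaPow ϖ (fun j => Finsupp.single j 1) v f) g = deltaPow ϖ e v (act ϖ e f g) := by
  have key1 : ∀ (j : Fin N) (k : ℕ) (f : FormalSums K N (Fin N →₀ ℕ)), IsOverconvergent absDeg f →
      IsOverconvergent absDeg ((GKZ.delta ϖ (fun j => Finsupp.single j 1) j ^ k) f) ∧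
      act ϖ e ((GKZ.delta ϖ (fun j => Finsupp.single j 1) j ^ k) f) g =
        (GKZ.delta ϖ e j ^ k) (act ϖ e f g) := by
    intro j k f hf
    induction k with
    | zero => simpa using hf
    | succ k ih =>
      rw [pow_succ', pow_succ', Module.End.mul_apply, Module.End.mul_apply, ← ih.2]
      exact ⟨ih.1.delta hϖ isWeight_absDeg j, act_delta hϖ hω j ih.1 hg⟩
  unfold deltaPow
  induction List.finRange N with
  | nil => simpa using hf
  | cons a l ih =>
    rw [List.map_cons, List.map_cons, List.prod_cons, List.prod_cons, Module.End.mul_apply,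
      Module.End.mul_apply, ← ih.2]
    exact key1 _ _ _ ih.1

theorem act_smul_left (hϖ : FactorialBound ϖ) (hω : IsWeight ω e) (a : MvPowerSeries (Fin N) K)
    (hf : IsOverconvergent absDeg f) (hg : IsOverconvergent ω g) :
    act ϖ e (a • f) g = a • act ϖ e f g := by
  rw [act, act, ← (summable_act hϖ hω hf hg).tsum_const_smul]
  simp only [Pi.smul_apply, smul_assoc]

/-- The action is compatible with composition of operators. -/
theorem act_act (hϖ : FactorialBound ϖ) (hω : IsWeight ω e)
    (hf : IsOverconvergent absDeg f) (hf' : IsOverconvergent absDeg f')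
    (hg : IsOverconvergent ω g) :
    act ϖ e (act ϖ (fun j => Finsupp.single j 1) f f') g = act ϖ e f (act ϖ e f' g) := by
  have hs := summable_act hϖ isWeight_absDeg hf hf'
  set G := fun v => f v • deltaPow ϖ (fun j => Finsupp.single j 1) v f' with hG
  have h1 : ∀ v, act ϖ e (G v) g = f v • deltaPow ϖ e v (act ϖ e f' g) := by
    intro v
    obtain ⟨h, h'⟩ := act_deltaPow hϖ hω v hf' hg
    rw [hG, act_smul_left hϖ hω _ h hg, h']
  have h2 : Summable (Function.uncurry fun k v => G v k • deltaPow ϖ e k g) := by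
    obtain ⟨r, hr, s, hs, C, hC, q, hq0, hq, h⟩ := exists_term_bound hϖ isWeight_absDeg hf hf'
    obtain ⟨r', hr', s', hs', C', hg⟩ := hg
    have h1 : (1 : ℝ) < min r r' := lt_min hr hr'
    obtain ⟨σ, hσ, hσ'⟩ := exists_between (lt_min hs hs')
    have hσs : σ < s := hσ'.trans_le (min_le_left _ _)
    have hg := hg.mono (r' := min r r') (s' := σ) hω.nonneg (by positivity) (by positivity)
      (min_le_right _ _) (hσ'.le.trans (min_le_right _ _))
    obtain ⟨B, hB, hB'⟩ := exists_deltaPow_bound hϖ hω.step h1 hσ (e := e)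
    have hs0 : 0 < s := by linarith
    refine summable_of_boundedBy (c := fun x => (C * (B * C')) * (σ / s) ^ x.1.degree *
      q ^ x.2.degree) hω.nonneg h1.le hσ.le ?_
      (tendsto_geometric_prod (by positivity) ((div_lt_one hs0).2 hσs) hq0 hq _)
    rintro ⟨k, v⟩
    have hv := (h v).mono (r' := min r r') (s' := s) absDeg_nonneg (by positivity)
      (by positivity) (min_le_left _ _) le_rfl
    refine (BoundedBy.smul (C' := C * q ^ v.degree / s ^ k.degree) (by positivity) (by positivity)
      (by positivity) (hB' k _ _ hg) fun u => ?_).mono_const (le_of_eq ?_)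
    · rw [le_div_iff₀ (by positivity)]
      have := hv k u
      rwa [absDeg, Real.rpow_natCast] at this
    · simp only [div_pow]
      ring
  calc act ϖ e (∑' v, G v) g = ∑' k, ∑' v, G v k • deltaPow ϖ e k g := by
        rw [act]
        refine tsum_congr fun k => ?_
        rw [tsum_apply hs]
        exact ((Pi.summable.1 hs k).tsum_smul_const _).symm
    _ = ∑' v, ∑' k, G v k • deltaPow ϖ e k g := h2.tsum_comm.symm
    _ = act ϖ e f (act ϖ e f' g) := tsum_congr h1

end Act

end Action

/-! ### The ring `D†` -/

section DDagger

theorem isUltrametricDist_of_padic (p : ℕ) [Fact p.Prime] (K : Type*) [NormedField K]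
    [NormedAlgebra ℚ_[p] K] : IsUltrametricDist K :=
  IsUltrametricDist.of_normedAlgebra ℚ_[p]

theorem completeSpace_of_padic (p : ℕ) [Fact p.Prime] (K : Type*) [NormedField K]
    [NormedAlgebra ℚ_[p] K] [FiniteDimensional ℚ_[p] K] : CompleteSpace K :=
  FiniteDimensional.complete ℚ_[p] K

theorem isOverconvergent_single {K : Type*} [NormedField K] {N : ℕ} {M : Type*} [DecidableEq M]
    (ω : M → ℝ) (m : M) (u : Fin N →₀ ℕ) :
    IsOverconvergent ω (Pi.single m (MvPowerSeries.monomial u (1 : K)) : FormalSums K N M) := by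
  classical
  refine ⟨2, by norm_num, 2, by norm_num, 2 ^ u.degree * 2 ^ ω m, fun m' u' => ?_⟩
  rcases eq_or_ne m' m with rfl | hm
  · rw [Pi.single_eq_same, MvPowerSeries.coeff_monomial]
    split_ifs with h
    · simp [h]
    · simp only [norm_zero, zero_mul]
      positivity
  · rw [Pi.single_eq_of_ne hm]
    simp only [map_zero, norm_zero, zero_mul]
    positivity

theorem deltaPow_single_one {K : Type*} [NormedField K] {N : ℕ} {M : Type*} [AddCommMonoid M]
    [IsCancelAdd M] [DecidableEq M] {ϖ : K} (hϖ : ϖ ≠ 0) (e : Fin N → M) (v : Fin N →₀ ℕ) (m : M) :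
    deltaPow ϖ e v (Pi.single m 1) = Pi.single ((∑ j, v j • e j) + m) 1 := by
  have h1 : ∀ j m, delta ϖ e j (Pi.single m 1) = Pi.single (e j + m) 1 := by
    intro j m
    rw [delta_apply hϖ]
    have h : dX j (Pi.single m 1 : FormalSums K N M) = 0 := by
      ext1 m'
      rcases eq_or_ne m' m with rfl | hm
      · simp
      · simp [Pi.single_eq_of_ne hm]
    rw [h, smul_zero, zero_add]
    ext1 m'
    by_cases h : ∃ a, e j + a = m'
    · obtain ⟨a, rfl⟩ := h
      rw [shift_add_apply]
      simp [Pi.single_apply]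
    · rw [shift_apply_of_not h, Pi.single_eq_of_ne]
      rintro rfl
      exact h ⟨_, rfl⟩
  have h2 : ∀ (j : Fin N) (k : ℕ) (m : M),
      (delta ϖ e j ^ k) (Pi.single m 1) = Pi.single (k • e j + m) 1 := by
    intro j k m
    induction k with
    | zero => simp
    | succ k ih => rw [pow_succ', Module.End.mul_apply, ih, h1, succ_nsmul', add_assoc]
  rw [deltaPow, ← List.sum_ofFn, List.ofFn_eq_map]
  induction List.finRange N with
  | nil => simp
  | cons a l ih =>
    rw [List.map_cons, List.map_cons, List.prod_cons, List.sum_cons, Module.End.mul_apply, ih, h2,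
      add_assoc]

variable {p : ℕ} [Fact p.Prime] {K : Type*} [NormedField K] [NormedAlgebra ℚ_[p] K]

/-- The formal operators `∑ᵥ fᵥ(x) ∂ᵛ / π^{|v|}`, given by their coefficients `fᵥ`, for which there
are `r > 1` and `s > 1` such that `fᵥ ∈ K{r⁻¹x}` and the numbers `‖fᵥ‖_r s^{|v|}` are bounded. -/
def DDagger (_ϖ : DworkPi p K) (N : ℕ) : Type _ :=
  overconvergent K N (absDeg (N := N)) absDeg_nonneg

variable {ϖ : DworkPi p K} {N : ℕ}

instance : AddCommGroup (DDagger ϖ N) :=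
  inferInstanceAs (AddCommGroup (overconvergent K N (absDeg (N := N)) absDeg_nonneg))

instance : Module K (DDagger ϖ N) :=
  inferInstanceAs (Module K (overconvergent K N (absDeg (N := N)) absDeg_nonneg))

namespace DDagger

/-- The coefficients `fᵥ` of `∑ᵥ fᵥ(x) ∂ᵛ / π^{|v|}`. -/
def symbol (P : DDagger ϖ N) : FormalSums K N (Fin N →₀ ℕ) := Subtype.val P

theorem isOverconvergent (P : DDagger ϖ N) : IsOverconvergent absDeg P.symbol := Subtype.property P

/-- The operator with given coefficients. -/
def ofSymbol (f : FormalSums K N (Fin N →₀ ℕ)) (hf : IsOverconvergent absDeg f) : DDagger ϖ N :=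
  ⟨f, hf⟩

theorem symbol_ofSymbol (f : FormalSums K N (Fin N →₀ ℕ)) (hf : IsOverconvergent absDeg f) :
    (ofSymbol f hf : DDagger ϖ N).symbol = f := rfl

theorem symbol_add (P Q : DDagger ϖ N) : (P + Q).symbol = P.symbol + Q.symbol := rfl

theorem symbol_zero : (0 : DDagger ϖ N).symbol = 0 := rfl

theorem symbol_injective : Function.Injective (symbol : DDagger ϖ N → _) :=
  Subtype.val_injective

/-- The operator `∂ᵛ / π^{|v|}`. -/
def dpow (v : Fin N →₀ ℕ) : DDagger ϖ N :=
  ofSymbol (Pi.single v 1) (isOverconvergent_single absDeg v 0)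

/-- The operator `∂ⱼ`. -/
def d (j : Fin N) : DDagger ϖ N := (ϖ : K) • dpow (Finsupp.single j 1)

/-- Multiplication by `xⱼ`. -/
def x (j : Fin N) : DDagger ϖ N :=
  ofSymbol (Pi.single 0 (MvPowerSeries.X j))
    (isOverconvergent_single absDeg 0 (Finsupp.single j 1))

variable [FiniteDimensional ℚ_[p] K]

/-- The composition `P Q` of two operators: as `∂ⱼ ∘ f = ∂f/∂xⱼ + f ∘ ∂ⱼ`, composition with `∂ⱼ` from
the left is `∇ⱼ = ∂/∂xⱼ + π Tʲ` on the formal sums `∑ᵥ fᵥ Tᵛ`, where `Tᵛ` stands for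
`∂ᵛ / π^{|v|}`. -/
instance : Mul (DDagger ϖ N) where
  mul P Q := ofSymbol (act (ϖ : K) (fun j => Finsupp.single j 1) P.symbol Q.symbol) (by
    have := isUltrametricDist_of_padic p K
    have := completeSpace_of_padic p K
    exact P.isOverconvergent.act ϖ.factorialBound isWeight_absDeg Q.isOverconvergent)

instance : One (DDagger ϖ N) where
  one := dpow 0

theorem symbol_mul (P Q : DDagger ϖ N) :
    (P * Q).symbol = act (ϖ : K) (fun j => Finsupp.single j 1) P.symbol Q.symbol := rfl

theorem symbol_one : (1 : DDagger ϖ N).symbol = Pi.single 0 1 := rfl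

theorem act_one {M : Type*} [AddCommMonoid M] [IsCancelAdd M] {e : Fin N → M}
    (g : FormalSums K N M) : act (ϖ : K) e (1 : DDagger ϖ N).symbol g = g := by
  have := isUltrametricDist_of_padic p K
  have := completeSpace_of_padic p K
  rw [symbol_one, act_single, one_smul, deltaPow_zero, Module.End.one_apply]

protected theorem mul_one' (P : DDagger ϖ N) : P * 1 = P := by
  have := isUltrametricDist_of_padic p K
  have := completeSpace_of_padic p K
  apply symbol_injective
  rw [symbol_mul, symbol_one]
  have h1 : ∀ v : Fin N →₀ ℕ, deltaPow (ϖ : K) (fun j => Finsupp.single j 1) v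
      (Pi.single 0 1 : FormalSums K N (Fin N →₀ ℕ)) = Pi.single v 1 := by
    intro v
    rw [deltaPow_single_one ϖ.factorialBound.1, add_zero]
    congr 1
    simp
  have hs := summable_act ϖ.factorialBound isWeight_absDeg P.isOverconvergent
    (1 : DDagger ϖ N).isOverconvergent
  ext1 w
  rw [act, tsum_apply (by simpa only [symbol_one] using hs), tsum_eq_single w]
  · simp [h1]
  · intro v hv
    simp [h1, Pi.single_eq_of_ne hv.symm]

instance : Ring (DDagger ϖ N) :=
  { (inferInstance : AddCommGroup (DDagger ϖ N)) with
    mul_assoc := fun P Q R => by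
      have := isUltrametricDist_of_padic p K
      have := completeSpace_of_padic p K
      exact symbol_injective (act_act ϖ.factorialBound isWeight_absDeg P.isOverconvergent
        Q.isOverconvergent R.isOverconvergent)
    one_mul := fun P => symbol_injective (act_one P.symbol)
    mul_one := DDagger.mul_one'
    zero_mul := fun P => by
      have := isUltrametricDist_of_padic p K
      have := completeSpace_of_padic p K
      exact symbol_injective act_zero_left
    mul_zero := fun P => by
      have := isUltrametricDist_of_padic p K
      have := completeSpace_of_padic p K
      exact symbol_injective act_zero_right
    left_distrib := fun P Q R => by
      have := isUltrametricDist_of_padic p K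
      have := completeSpace_of_padic p K
      exact symbol_injective (act_add_right ϖ.factorialBound isWeight_absDeg P.isOverconvergent
        Q.isOverconvergent R.isOverconvergent)
    right_distrib := fun P Q R => by
      have := isUltrametricDist_of_padic p K
      have := completeSpace_of_padic p K
      exact symbol_injective (act_add_left ϖ.factorialBound isWeight_absDeg P.isOverconvergent
        Q.isOverconvergent R.isOverconvergent) }

end DDagger

end DDagger

/-! ### The module `L†′` -/

section LPrime

open scoped Pointwise

variable {n N : ℕ} (A : Matrix (Fin n) (Fin N) ℤ)

/-- The monoid `C(A) = {k₁ w₁ + ⋯ + k_N w_N : kⱼ ∈ ℤ_{≥ 0}}`, where `wⱼ` is the `j`-th column of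
`A`. -/
def columnMonoid : AddSubmonoid (Fin n → ℤ) :=
  AddSubmonoid.closure (Set.range fun (j : Fin N) (i : Fin n) => A i j)

/-- The `j`-th column `wⱼ` of `A`, as an element of `C(A)`. -/
def column (j : Fin N) : columnMonoid A :=
  ⟨fun i => A i j, AddSubmonoid.subset_closure ⟨j, rfl⟩⟩

/-- The polytope `Δ`, the convex hull of `0, w₁, …, w_N` in `ℝⁿ`. -/
def polytope : Set (Fin n → ℝ) :=
  convexHull ℝ (insert 0 (Set.range fun (j : Fin N) (i : Fin n) => (A i j : ℝ)))

/-- `d(w) = inf {a > 0 : w ∈ a Δ}`. -/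
def polytopeWeight (w : columnMonoid A) : ℝ :=
  sInf {a : ℝ | 0 < a ∧ (fun i => ((w : Fin n → ℤ) i : ℝ)) ∈ a • polytope A}

theorem polytopeWeight_nonneg (w : columnMonoid A) : 0 ≤ polytopeWeight A w :=
  Real.sInf_nonneg fun _ ha => ha.1.le

theorem add_mem_smul_polytope {y : Fin n → ℝ} {a : ℝ} (ha : 0 ≤ a) (h : y ∈ a • polytope A)
    (j : Fin N) : (fun i => (A i j : ℝ)) + y ∈ (a + 1) • polytope A := by
  have hc : Convex ℝ (polytope A) := convex_convexHull _ _
  rw [hc.add_smul ha zero_le_one, one_smul, add_comm _ y]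
  exact Set.add_mem_add h (subset_convexHull _ _ (Or.inr ⟨j, rfl⟩))

theorem exists_mem_smul_polytope (w : columnMonoid A) :
    ∃ a : ℝ, 0 < a ∧ (fun i => ((w : Fin n → ℤ) i : ℝ)) ∈ a • polytope A := by
  obtain ⟨w, hw⟩ := w
  have h0 : (0 : Fin n → ℝ) ∈ polytope A := subset_convexHull _ _ (Or.inl rfl)
  induction hw using AddSubmonoid.closure_induction_left with
  | zero => exact ⟨1, one_pos, by rw [one_smul]; convert h0 using 1; ext i; simp⟩
  | add_left x hx y hy ih =>
    obtain ⟨j, rfl⟩ := hx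
    obtain ⟨a, ha, h⟩ := ih
    refine ⟨a + 1, by linarith, ?_⟩
    convert add_mem_smul_polytope A ha.le h j using 1
    ext i
    simp

theorem isWeight_polytopeWeight : IsWeight (polytopeWeight A) (column A) := by
  refine ⟨polytopeWeight_nonneg A, fun j w => ?_⟩
  rw [← sub_le_iff_le_add]
  refine le_csInf (exists_mem_smul_polytope A w) fun a ha => ?_
  rw [sub_le_iff_le_add]
  refine csInf_le ⟨0, fun b hb => hb.1.le⟩ ⟨by linarith [ha.1], ?_⟩
  convert add_mem_smul_polytope A ha.1.le ha.2 j using 1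
  ext i
  simp [column]

/-- The space `L†′` of the series `∑ a_w(x) t^w`, with `w ∈ C(A)`, for which there are `r > 1` and
`s > 1` such that `a_w ∈ K{r⁻¹x}` and the numbers `‖a_w‖_r s^{d(w)}` are bounded. -/
def LPrime (K : Type*) [NormedField K] :
    Submodule K (FormalSums K N (columnMonoid A)) :=
  overconvergent K N (polytopeWeight A) (polytopeWeight_nonneg A)

/-- The series `1 ∈ L†′`. -/
instance (K : Type*) [NormedField K] : One (LPrime A K) where
  one := ⟨Pi.single 0 1, isOverconvergent_single _ 0 0⟩

/-- The derivation `tᵢ ∂/∂tᵢ`, given by `t^w ↦ wᵢ t^w`. -/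
def tDeriv {A : Matrix (Fin n) (Fin N) ℤ} {K : Type*} [NormedField K] (i : Fin n) :
    FormalSums K N (columnMonoid A) →ₗ[MvPowerSeries (Fin N) K]
      FormalSums K N (columnMonoid A) where
  toFun g w := (((w : Fin n → ℤ) i : ℤ) : K) • g w
  map_add' g g' := by
    ext1 w
    simp
  map_smul' a g := by
    ext1 w
    simp

variable {A} {p : ℕ} [Fact p.Prime] {K : Type*} [NormedField K] [NormedAlgebra ℚ_[p] K]
  [FiniteDimensional ℚ_[p] K] {ϖ : DworkPi p K}

/-- `D†` acts on `L†′`, with `∂ⱼ` acting as `∇ⱼ = ∂/∂xⱼ + π t^{wⱼ}`. -/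
instance : Module (DDagger ϖ N) (LPrime A K) where
  smul P g := ⟨act (ϖ : K) (column A) P.symbol g, by
    have := isUltrametricDist_of_padic p K
    have := completeSpace_of_padic p K
    exact P.isOverconvergent.act ϖ.factorialBound (isWeight_polytopeWeight A) g.2⟩
  one_smul g := Subtype.ext (DDagger.act_one g.1)
  mul_smul P Q g := by
    have := isUltrametricDist_of_padic p K
    have := completeSpace_of_padic p K
    exact Subtype.ext (act_act ϖ.factorialBound (isWeight_polytopeWeight A) P.isOverconvergent
      Q.isOverconvergent g.2)
  smul_zero P := by
    have := isUltrametricDist_of_padic p K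
    have := completeSpace_of_padic p K
    exact Subtype.ext act_zero_right
  smul_add P g g' := by
    have := isUltrametricDist_of_padic p K
    have := completeSpace_of_padic p K
    exact Subtype.ext (act_add_right ϖ.factorialBound (isWeight_polytopeWeight A)
      P.isOverconvergent g.2 g'.2)
  add_smul P Q g := by
    have := isUltrametricDist_of_padic p K
    have := completeSpace_of_padic p K
    exact Subtype.ext (act_add_left ϖ.factorialBound (isWeight_polytopeWeight A)
      P.isOverconvergent Q.isOverconvergent g.2)
  zero_smul g := by
    have := isUltrametricDist_of_padic p K
    have := completeSpace_of_padic p K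
    exact Subtype.ext act_zero_left

theorem coe_smul_LPrime (P : DDagger ϖ N) (g : LPrime A K) :
    ((P • g : LPrime A K) : FormalSums K N (columnMonoid A)) =
      act (ϖ : K) (column A) P.symbol g := rfl

end LPrime

/-! ### The operators `F_{i,γ}` -/

section TwistedOperators

variable {n N : ℕ} {A : Matrix (Fin n) (Fin N) ℤ} {K : Type*} [NormedField K]

/-- The operator `g ↦ π ∑ⱼ w_{ij} xⱼ t^{wⱼ} g`. -/
def mulPiF (A : Matrix (Fin n) (Fin N) ℤ) (ϖ : K) (i : Fin n) :
    FormalSums K N (columnMonoid A) →ₗ[MvPowerSeries (Fin N) K]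
      FormalSums K N (columnMonoid A) :=
  ϖ • ∑ j : Fin N, (A i j : K) •
    (MvPowerSeries.X j : MvPowerSeries (Fin N) K) • shift (column A j)

/-- `F_{i,γ} = tᵢ ∂/∂tᵢ + γᵢ + π ∑ⱼ w_{ij} xⱼ t^{wⱼ}`, on formal series. -/
def formalF (A : Matrix (Fin n) (Fin N) ℤ) (ϖ : K) (γ : Fin n → K) (i : Fin n) :
    FormalSums K N (columnMonoid A) →ₗ[MvPowerSeries (Fin N) K]
      FormalSums K N (columnMonoid A) :=
  tDeriv i + γ i • LinearMap.id + mulPiF A ϖ i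

theorem mulPiF_apply (ϖ : K) (i : Fin n) (g : FormalSums K N (columnMonoid A)) :
    mulPiF A ϖ i g = ϖ • ∑ j : Fin N, (A i j : K) •
      (MvPowerSeries.X j : MvPowerSeries (Fin N) K) • shift (column A j) g := by
  simp [mulPiF]

theorem formalF_apply (ϖ : K) (γ : Fin n → K) (i : Fin n)
    (g : FormalSums K N (columnMonoid A)) :
    formalF A ϖ γ i g = tDeriv i g + γ i • g + mulPiF A ϖ i g := by
  simp [formalF]

theorem tDeriv_shift (i : Fin n) (j : Fin N) (g : FormalSums K N (columnMonoid A)) :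
    tDeriv i (shift (column A j) g) =
      shift (column A j) (tDeriv i g) + (A i j : K) • shift (column A j) g := by
  ext1 m
  by_cases h : ∃ m', column A j + m' = m
  · obtain ⟨m, rfl⟩ := h
    rw [Pi.add_apply, Pi.smul_apply, shift_add_apply, shift_add_apply]
    simp only [tDeriv, LinearMap.coe_mk, AddHom.coe_mk, shift_add_apply]
    simp [column, add_smul, add_comm]
  · simp [tDeriv, shift_apply_of_not h]

theorem tDeriv_dX (i : Fin n) (j : Fin N) (g : FormalSums K N (columnMonoid A)) :
    tDeriv i (dX j g) = dX j (tDeriv i g) := by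
  ext1 m
  simp [tDeriv]

theorem tDeriv_tDeriv (i i' : Fin n) (g : FormalSums K N (columnMonoid A)) :
    tDeriv i (tDeriv i' g) = tDeriv i' (tDeriv i g) := by
  ext1 m
  simp [tDeriv, smul_smul, mul_comm]

theorem tDeriv_mulPiF (ϖ : K) (i i' : Fin n) (g : FormalSums K N (columnMonoid A)) :
    tDeriv i (mulPiF A ϖ i' g) = mulPiF A ϖ i' (tDeriv i g) + ϖ • ∑ j : Fin N,
      ((A i j : K) * (A i' j : K)) • (MvPowerSeries.X j : MvPowerSeries (Fin N) K) •
        shift (column A j) g := by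
  simp only [mulPiF_apply, LinearMap.map_smul_of_tower, map_sum, map_smul, tDeriv_shift, smul_add,
    Finset.sum_add_distrib]
  congr 3
  ext1 j
  simp only [const_smul_eq_C_smul, smul_smul, map_mul]
  congr 1
  ring

theorem mulPiF_shift (ϖ : K) (i : Fin n) (j : Fin N) (g : FormalSums K N (columnMonoid A)) :
    mulPiF A ϖ i (shift (column A j) g) = shift (column A j) (mulPiF A ϖ i g) := by
  simp only [mulPiF_apply, LinearMap.map_smul_of_tower, map_sum, map_smul, shift_shift,
    add_comm (column A j)]

theorem mulPiF_mulPiF (ϖ : K) (i i' : Fin n) (g : FormalSums K N (columnMonoid A)) :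
    mulPiF A ϖ i (mulPiF A ϖ i' g) = mulPiF A ϖ i' (mulPiF A ϖ i g) := by
  rw [mulPiF_apply ϖ i', LinearMap.map_smul_of_tower, map_sum, mulPiF_apply ϖ i' (mulPiF A ϖ i g)]
  congr 1
  refine Finset.sum_congr rfl fun j _ => ?_
  rw [LinearMap.map_smul_of_tower, map_smul, mulPiF_shift]

theorem dX_mulPiF (ϖ : K) (i : Fin n) (j : Fin N) (g : FormalSums K N (columnMonoid A)) :
    dX j (mulPiF A ϖ i g) =
      mulPiF A ϖ i (dX j g) + ϖ • (A i j : K) • shift (column A j) g := by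
  have h : ∀ k : Fin N, (A i k : K) • MvPowerSeries.pderiv K j (MvPowerSeries.X k) •
      shift (column A k) g = if k = j then (A i j : K) • shift (column A j) g else 0 := by
    intro k
    split_ifs with hk
    · subst hk
      rw [MvPowerSeries.pderiv_X_self, one_smul]
    · rw [MvPowerSeries.pderiv_X_of_ne hk, zero_smul, smul_zero]
  simp only [mulPiF_apply, map_smul, map_sum, dX_smul, smul_add, Finset.sum_add_distrib, dX_shift,
    h]
  rw [add_comm]
  simp

/-- The operators `F_{i,γ}` commute with each other. -/
theorem formalF_comm (ϖ : K) (γ : Fin n → K) (i i' : Fin n)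
    (g : FormalSums K N (columnMonoid A)) :
    formalF A ϖ γ i (formalF A ϖ γ i' g) = formalF A ϖ γ i' (formalF A ϖ γ i g) := by
  simp only [formalF_apply, map_add, LinearMap.map_smul_of_tower, tDeriv_mulPiF,
    tDeriv_tDeriv i i', mulPiF_mulPiF ϖ i i', smul_add, mul_comm (A i _ : K),
    smul_comm (γ i) (γ i')]
  abel

/-- The operators `F_{i,γ}` commute with the operators `∇ⱼ`. -/
theorem formalF_delta {ϖ : K} (hϖ : ϖ ≠ 0) (γ : Fin n → K) (i : Fin n) (j : Fin N)
    (g : FormalSums K N (columnMonoid A)) :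
    formalF A ϖ γ i (delta ϖ (column A) j g) = delta ϖ (column A) j (formalF A ϖ γ i g) := by
  have h : ϖ⁻¹ • ϖ • (A i j : K) • shift (column A j) g = (A i j : K) • shift (column A j) g := by
    rw [smul_smul, inv_mul_cancel₀ hϖ, one_smul]
  simp only [delta_apply hϖ, formalF_apply, map_add, LinearMap.map_smul_of_tower, tDeriv_shift,
    tDeriv_dX, mulPiF_shift, dX_mulPiF, smul_add, h, map_smul]
  abel

theorem formalF_deltaPow {ϖ : K} (hϖ : ϖ ≠ 0) (γ : Fin n → K) (i : Fin n) (v : Fin N →₀ ℕ)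
    (g : FormalSums K N (columnMonoid A)) :
    formalF A ϖ γ i (deltaPow ϖ (column A) v g) = deltaPow ϖ (column A) v (formalF A ϖ γ i g) := by
  have h1 : ∀ j, Commute ((formalF A ϖ γ i).restrictScalars K :
      Module.End K (FormalSums K N (columnMonoid A))) (delta ϖ (column A) j) := by
    intro j
    ext1 g
    exact formalF_delta hϖ γ i j g
  have h2 : Commute ((formalF A ϖ γ i).restrictScalars K :
      Module.End K (FormalSums K N (columnMonoid A))) (deltaPow ϖ (column A) v) := by
    refine Commute.list_prod_right _ _ fun x hx => ?_
    obtain ⟨j, -, rfl⟩ := List.mem_map.1 hx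
    exact (h1 j).pow_right _
  exact LinearMap.congr_fun h2.eq g

theorem continuous_mulPiF (ϖ : K) (i : Fin n) :
    Continuous (mulPiF A ϖ i :
      FormalSums K N (columnMonoid A) → FormalSums K N (columnMonoid A)) := by
  have : (mulPiF A ϖ i : FormalSums K N (columnMonoid A) → FormalSums K N (columnMonoid A)) =
      fun g => ϖ • ∑ j : Fin N, (A i j : K) •
        (MvPowerSeries.X j : MvPowerSeries (Fin N) K) • shift (column A j) g :=
    funext (mulPiF_apply ϖ i)
  rw [this]
  refine (continuous_K_smul _).comp (continuous_finsetSum _ fun j _ => ?_)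
  exact (continuous_K_smul _).comp ((continuous_const_smul _).comp (continuous_shift _))

theorem continuous_formalF (ϖ : K) (γ : Fin n → K) (i : Fin n) :
    Continuous (formalF A ϖ γ i :
      FormalSums K N (columnMonoid A) → FormalSums K N (columnMonoid A)) := by
  have : (formalF A ϖ γ i : FormalSums K N (columnMonoid A) → FormalSums K N (columnMonoid A)) =
      fun g => tDeriv i g + γ i • g + mulPiF A ϖ i g :=
    funext (formalF_apply ϖ γ i)
  rw [this]
  refine (Continuous.add ?_ (continuous_K_smul _)).add (continuous_mulPiF _ _)
  refine continuous_pi fun w => ?_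
  have h : (fun g : FormalSums K N (columnMonoid A) => tDeriv i g w) =
      fun g => (MvPowerSeries.C (((w : Fin n → ℤ) i : ℤ) : K) : MvPowerSeries (Fin N) K) * g w := by
    ext1 g
    simp [tDeriv, MvPowerSeries.smul_eq_C_mul]
  rw [h]
  exact continuous_const.mul (continuous_apply w)

theorem IsOverconvergent.formalF [IsUltrametricDist K] {g : FormalSums K N (columnMonoid A)}
    (hg : g ∈ LPrime A K) (ϖ : K) (γ : Fin n → K) (i : Fin n) :
    formalF A ϖ γ i g ∈ LPrime A K := by
  rw [formalF_apply, mulPiF_apply]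
  refine add_mem (add_mem ?_ (Submodule.smul_mem _ _ hg)) (Submodule.smul_mem _ _
    (sum_mem fun j _ => Submodule.smul_mem _ _ ?_))
  · obtain ⟨r, hr, s, hs, C, h⟩ := hg
    refine ⟨r, hr, s, hs, C, fun w u => ?_⟩
    refine le_trans ?_ (h w u)
    have h1 : ‖(((w : Fin n → ℤ) i : ℤ) : K)‖ ≤ 1 := IsUltrametricDist.norm_intCast_le_one K _
    simp only [tDeriv, LinearMap.coe_mk, AddHom.coe_mk, MvPowerSeries.coeff_smul, norm_mul]
    gcongr
    exact mul_le_of_le_one_left (norm_nonneg _) h1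
  · obtain ⟨r, hr, s, hs, C, h⟩ : IsOverconvergent (polytopeWeight A) (GKZ.shift (column A j) g) :=
      IsOverconvergent.shift ((isWeight_polytopeWeight A).step j) hg
    refine ⟨r, hr, s, hs, r * C, h.smul (by linarith) (by linarith) (by linarith) fun u => ?_⟩
    classical
    rw [MvPowerSeries.coeff_X]
    split_ifs with hu
    · simp [hu]
    · simp only [norm_zero, zero_mul]
      linarith

variable {p : ℕ} [Fact p.Prime] [NormedAlgebra ℚ_[p] K] [FiniteDimensional ℚ_[p] K]

/-- The `D†`-linear operator `F_{i,γ} = tᵢ ∂/∂tᵢ + γᵢ + π ∑ⱼ w_{ij} xⱼ t^{wⱼ}` on `L†′`. -/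
def opF (A : Matrix (Fin n) (Fin N) ℤ) (ϖ : DworkPi p K) (γ : Fin n → K) (i : Fin n) :
    LPrime A K →ₗ[DDagger ϖ N] LPrime A K where
  toFun g := ⟨formalF A (ϖ : K) γ i g, by
    have := isUltrametricDist_of_padic p K
    exact IsOverconvergent.formalF g.2 _ _ _⟩
  map_add' g g' := Subtype.ext (map_add _ _ _)
  map_smul' P g := by
    have := isUltrametricDist_of_padic p K
    have := completeSpace_of_padic p K
    apply Subtype.ext
    have hs := summable_act ϖ.factorialBound (isWeight_polytopeWeight A) P.isOverconvergent g.2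
    change formalF A (ϖ : K) γ i (act (ϖ : K) (column A) P.symbol g) =
      act (ϖ : K) (column A) P.symbol (formalF A (ϖ : K) γ i g)
    rw [act, act, hs.map_tsum (formalF A (ϖ : K) γ i) (continuous_formalF _ _ _)]
    refine tsum_congr fun v => ?_
    rw [map_smul, formalF_deltaPow ϖ.factorialBound.1]

theorem opF_comm (A : Matrix (Fin n) (Fin N) ℤ) (ϖ : DworkPi p K) (γ : Fin n → K) (i i' : Fin n)
    (g : LPrime A K) : opF A ϖ γ i (opF A ϖ γ i' g) = opF A ϖ γ i' (opF A ϖ γ i g) :=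
  Subtype.ext (formalF_comm _ _ _ _ _)

end TwistedOperators

/-! ### The twisted de Rham complex -/

section DeRham

variable {R L : Type*} [Ring R] [AddCommGroup L] [Module R L] {n : ℕ}

/-- The space `C^k` of forms `∑ f_{i₁…i_k} dt_{i₁}/t_{i₁} ∧ ⋯ ∧ dt_{i_k}/t_{i_k}` with coefficients
in `L`, the sum taken over the subsets `{i₁ < ⋯ < i_k}` of the index set. -/
abbrev Forms (L : Type*) (n k : ℕ) : Type _ := {s : Finset (Fin n) // s.card = k} → L

/-- The differential `f dt_S/t_S ↦ ∑ᵢ F_i(f) dtᵢ/tᵢ ∧ dt_S/t_S`: its coefficient at a set `J` is the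
sum over `i ∈ J` of `(-1)^{#{j ∈ J : j < i}} F_i(f_{J ∖ {i}})`. -/
def formsD (F : Fin n → L →ₗ[R] L) (k : ℕ) : Forms L n k →ₗ[R] Forms L n (k + 1) :=
  LinearMap.pi fun J => ∑ i : J.1,
    ((-1 : ℤ) ^ (J.1.filter (· < i.1)).card) • F i.1 ∘ₗ
      LinearMap.proj (⟨J.1.erase i.1, by rw [Finset.card_erase_of_mem i.2, J.2]; rfl⟩ :
        {s : Finset (Fin n) // s.card = k})

theorem formsD_apply (F : Fin n → L →ₗ[R] L) (k : ℕ) (ω : Forms L n k)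
    (J : {s : Finset (Fin n) // s.card = k + 1}) :
    formsD F k ω J = ∑ i : J.1, ((-1 : ℤ) ^ (J.1.filter (· < i.1)).card) •
      F i.1 (ω ⟨J.1.erase i.1, by rw [Finset.card_erase_of_mem i.2, J.2]; rfl⟩) := by
  simp [formsD]

/-- The boundaries in degree `k`, that is, the image of `C^{k-1}` (with `C^{-1} = 0`). -/
def boundaries (F : Fin n → L →ₗ[R] L) : (k : ℕ) → Submodule R (Forms L n k)
  | 0 => ⊥
  | k + 1 => LinearMap.range (formsD F k)

/-- The cohomology `H^k` of the complex of forms. -/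
abbrev Cohomology (F : Fin n → L →ₗ[R] L) (k : ℕ) : Type _ :=
  LinearMap.ker (formsD F k) ⧸ (boundaries F k).submoduleOf (LinearMap.ker (formsD F k))

/-- For commuting `F_i`, the differential squares to zero. -/
theorem formsD_formsD (F : Fin n → L →ₗ[R] L) (hF : ∀ i j g, F i (F j g) = F j (F i g)) (k : ℕ)
    (ω : Forms L n k) : formsD F (k + 1) (formsD F k ω) = 0 := by
  classical
  -- extend the coefficients to all finite sets
  let c : Finset (Fin n) → L := fun s => if h : s.card = k then ω ⟨s, h⟩ else 0
  have hc : ∀ (s : Finset (Fin n)) (h : s.card = k), ω ⟨s, h⟩ = c s := fun s h => by simp [c, h]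
  have hD : ∀ J, formsD F k ω J = ∑ i ∈ J.1,
      ((-1 : ℤ) ^ (J.1.filter (· < i)).card) • F i (c (J.1.erase i)) := by
    intro J
    rw [← Finset.sum_coe_sort J.1, formsD_apply]
    simp only [hc]
  ext1 J
  have hDD : formsD F (k + 1) (formsD F k ω) J = ∑ i ∈ J.1, ∑ j ∈ J.1.erase i,
      ((-1 : ℤ) ^ (J.1.filter (· < i)).card * (-1 : ℤ) ^ ((J.1.erase i).filter (· < j)).card) •
        F i (F j (c ((J.1.erase i).erase j))) := by
    rw [← Finset.sum_coe_sort J.1]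
    rw [formsD_apply]
    refine Finset.sum_congr rfl fun i _ => ?_
    rw [hD, map_sum, Finset.smul_sum]
    refine Finset.sum_congr rfl fun j _ => ?_
    rw [map_zsmul, smul_smul]
  rw [hDD, Pi.zero_apply, Finset.sum_sigma']
  refine Finset.sum_involution (fun x _ => ⟨x.2, x.1⟩) ?_ ?_ ?_ ?_
  · rintro ⟨i, j⟩ h
    simp only [Finset.mem_sigma, Finset.mem_erase] at h
    obtain ⟨hi, hji, hj⟩ := h
    simp only
    rw [Finset.erase_right_comm, hF j i, ← add_smul]
    have key : ∀ i j : Fin n, i ∈ J.1 → j ∈ J.1 → i < j →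
        (-1 : ℤ) ^ (J.1.filter (· < i)).card * (-1 : ℤ) ^ ((J.1.erase i).filter (· < j)).card +
        (-1 : ℤ) ^ (J.1.filter (· < j)).card * (-1 : ℤ) ^ ((J.1.erase j).filter (· < i)).card
          = 0 := by
      intro i j hi hj hij
      have h1 : (J.1.erase j).filter (· < i) = J.1.filter (· < i) := by
        ext x
        simp only [Finset.mem_filter, Finset.mem_erase]
        constructor
        · rintro ⟨⟨_, h⟩, h'⟩
          exact ⟨h, h'⟩
        · rintro ⟨h, h'⟩
          exact ⟨⟨(h'.trans hij).ne, h⟩, h'⟩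
      have h2 : (J.1.filter (· < j)).card = ((J.1.erase i).filter (· < j)).card + 1 := by
        rw [Finset.filter_erase, Finset.card_erase_add_one]
        simp [hi, hij]
      rw [h1, h2, pow_succ]
      ring
    have : (-1 : ℤ) ^ (J.1.filter (· < i)).card * (-1 : ℤ) ^ ((J.1.erase i).filter (· < j)).card +
        (-1 : ℤ) ^ (J.1.filter (· < j)).card * (-1 : ℤ) ^ ((J.1.erase j).filter (· < i)).card
          = 0 := by
      rcases lt_or_gt_of_ne hji with h | h
      · rw [add_comm]
        exact key j i hj hi h
      · exact key i j hi hj h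
    rw [this, zero_smul]
  · rintro ⟨i, j⟩ h _ h'
    simp only [Finset.mem_sigma, Finset.mem_erase] at h
    simp only [Sigma.mk.injEq] at h'
    exact h.2.1 h'.1
  · rintro ⟨i, j⟩ h
    simp only [Finset.mem_sigma, Finset.mem_erase] at h ⊢
    exact ⟨h.2.2, h.2.1.symm, h.1⟩
  · rintro ⟨i, j⟩ h
    rfl

/-- The map `f ↦ f dt₁/t₁ ∧ ⋯ ∧ dtₙ/tₙ` from `L` to the cocycles of degree `n`. -/
def topForm (F : Fin n → L →ₗ[R] L) : L →ₗ[R] LinearMap.ker (formsD F n) :=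
  LinearMap.codRestrict _ (LinearMap.pi fun _ => LinearMap.id) fun f => by
    rw [LinearMap.mem_ker]
    ext1 J
    have h := Finset.card_le_univ J.1
    rw [J.2, Fintype.card_fin] at h
    omega

end DeRham

/-! ### The hypergeometric system -/

section System

variable {n N : ℕ} {p : ℕ} [Fact p.Prime] {K : Type*} [NormedField K] [NormedAlgebra ℚ_[p] K]
  [FiniteDimensional ℚ_[p] K]

/-- The lattice of integral relations `Λ = {λ : ∑ⱼ λⱼ wⱼ = 0}`. -/
def relations (A : Matrix (Fin n) (Fin N) ℤ) : Set (Fin N → ℤ) :=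
  {l | ∀ i, ∑ j, l j * A i j = 0}

/-- `□_λ = ∏_{λⱼ>0} (π⁻¹ ∂ⱼ)^{λⱼ} - ∏_{λⱼ<0} (π⁻¹ ∂ⱼ)^{-λⱼ}`. -/
def box (ϖ : DworkPi p K) (l : Fin N → ℤ) : DDagger ϖ N :=
  DDagger.dpow (Finsupp.equivFunOnFinite.symm fun j => (l j).toNat) -
    DDagger.dpow (Finsupp.equivFunOnFinite.symm fun j => (-l j).toNat)

/-- `E_{i,γ} = ∑ⱼ w_{ij} xⱼ ∂ⱼ + γᵢ`. -/
def opE (A : Matrix (Fin n) (Fin N) ℤ) (ϖ : DworkPi p K) (γ : Fin n → K) (i : Fin n) :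
    DDagger ϖ N :=
  ∑ j, (A i j : K) • (DDagger.x j * DDagger.d j) + γ i • (1 : DDagger ϖ N)

/-- The left ideal `∑_λ D† □_λ`. -/
def boxIdeal (A : Matrix (Fin n) (Fin N) ℤ) (ϖ : DworkPi p K) :
    Submodule (DDagger ϖ N) (DDagger ϖ N) :=
  Submodule.span (DDagger ϖ N) (box ϖ '' relations A)

/-- The left ideal `∑ᵢ D† E_{i,γ}`. -/
def eulerIdeal (A : Matrix (Fin n) (Fin N) ℤ) (ϖ : DworkPi p K) (γ : Fin n → K) :
    Submodule (DDagger ϖ N) (DDagger ϖ N) :=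
  Submodule.span (DDagger ϖ N) (Set.range (opE A ϖ γ))

/-- The submodule `∑ᵢ F_{i,γ} L†′` of `L†′`. -/
def imageF (A : Matrix (Fin n) (Fin N) ℤ) (ϖ : DworkPi p K) (γ : Fin n → K) :
    Submodule (DDagger ϖ N) (LPrime A K) :=
  ⨆ i, LinearMap.range (opF A ϖ γ i)

/-- The homomorphism `φ : D† → L†′`, `P ↦ P · 1`. -/
def phi (A : Matrix (Fin n) (Fin N) ℤ) (ϖ : DworkPi p K) : DDagger ϖ N →ₗ[DDagger ϖ N] LPrime A K :=
  LinearMap.toSpanSingleton (DDagger ϖ N) (LPrime A K) 1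

end System

end GKZ

end

/-! Write `T^v` for `∂^v / π^{|v|}`. On a monomial with constant coefficient the derivative in `x_j`
vanishes, so `π⁻¹∇_j` acts on it as multiplication by `t^{w_j}`. Hence `φ` sends `∑ f_v T^v` to `∑
f_v t^{∑ v_j w_j}`: it adds up the coefficients along the fibres of the monoid homomorphism
`columnSum` from `ℕ^N` onto `C(A)` (`hasSum_phi`). The theorem thereby becomes a statement about
this homomorphism, provided that degrees in `ℕ^N` and weights on `C(A)` are linearly comparable.

Finite generation of equalizers of monoid homomorphisms (`AddSubmonoid.fg_eqLocusM`) is used twice.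
It yields a section `ν` of `columnSum` with `|ν(w)| ≤ D d(w)` (`exists_section`), and finitely many
relations whose binomials generate all differences `T^v - T^{v'}` over a common point of `C(A)`,
with control of degrees (`exists_finite_relations`).

Surjectivity of `φ` follows by placing the coefficient of `t^w` at the exponent `ν(w)`. If `φ(P) =
0`, the coefficients of `P = ∑ f_v T^v` sum to zero on every fibre, so `P = ∑ f_v (T^v - T^{ν(w)})`
with `w = columnSum v`. Expanding each difference in the finitely many binomials gives `P = ∑ Q_i
□_{μ_i}`. The series `Q_i` remain overconvergent after shrinking `s`, because all degrees grow at
most linearly in `|v|`. This proves both the first isomorphism and finite generation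
(`exists_span_box_eq_ker`).

For the second isomorphism, `φ(E_{i,γ}) = F_{i,γ}(1)` (`phi_opE`). Since `F_{i,γ}` is `D†`-linear
and `1` generates `L†′`, the Euler ideal maps onto `∑ F_{i,γ} L†′`. The third is formal: a form of
top degree has one coefficient, and its boundaries are sums of `±F_i` applied to arbitrary elements.
-/

namespace GKZ

/-! ### Degrees in `ℕ^N` against the weight on `C(A)` -/

section Semigroup

open scoped Pointwise

variable {n N : ℕ} (A : Matrix (Fin n) (Fin N) ℤ)

/-- The homomorphism `v ↦ ∑ⱼ vⱼ wⱼ` from `ℕ^N` to `C(A)`. -/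
def columnSum : (Fin N →₀ ℕ) →+ columnMonoid A where
  toFun v := ∑ j, v j • column A j
  map_zero' := by simp
  map_add' v w := by simp [add_smul, Finset.sum_add_distrib]

theorem columnSum_apply (v : Fin N →₀ ℕ) : columnSum A v = ∑ j, v j • column A j := rfl

theorem coe_columnSum (v : Fin N →₀ ℕ) (i : Fin n) :
    (columnSum A v : Fin n → ℤ) i = ∑ j, (v j : ℤ) * A i j := by
  simp [columnSum_apply, column]

theorem columnSum_single (j : Fin N) : columnSum A (Finsupp.single j 1) = column A j := by
  classical
  rw [columnSum_apply, Finset.sum_eq_single j]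
  · simp
  · intro k _ hk
    simp [Finsupp.single_eq_of_ne hk]
  · simp

theorem columnSum_surjective : Function.Surjective (columnSum A) := by
  rintro ⟨w, hw⟩
  induction hw using AddSubmonoid.closure_induction with
  | zero => exact ⟨0, map_zero _⟩
  | mem x hx =>
    obtain ⟨j, rfl⟩ := hx
    exact ⟨Finsupp.single j 1, columnSum_single A j⟩
  | add x y hx hy ihx ihy =>
    obtain ⟨v, hv⟩ := ihx
    obtain ⟨v', hv'⟩ := ihy
    exact ⟨v + v', by rw [map_add, hv, hv']; rfl⟩

/-- Every element of `C(A)` is a combination of the columns whose degree is bounded linearly. -/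
theorem exists_columnSum_eq_degree_le : ∃ D : ℕ, ∀ w : columnMonoid A,
    ∃ v, columnSum A v = w ∧ v.degree ≤ D * ∑ i, ((w : Fin n → ℤ) i).natAbs := by
  -- The triples `(v, a, b)` with `∑ v_j w_j + b = a` form a finitely generated monoid. The vectors
  -- `a` and `b` record an integer point as a difference of nonnegative ones, so that all the data
  -- stay in a free commutative monoid.
  let X := (Fin N →₀ ℕ) × (Fin n →₀ ℕ) × (Fin n →₀ ℕ)
  let c : (Fin n →₀ ℕ) →+ (Fin n → ℤ) :=
    { toFun := fun a i => a i
      map_zero' := by ext; simp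
      map_add' := fun a b => by ext; simp }
  let f : X →+ (Fin n → ℤ) :=
    ((columnMonoid A).subtype.comp (columnSum A)).comp (AddMonoidHom.fst _ _) +
      (c.comp (AddMonoidHom.snd _ _)).comp (AddMonoidHom.snd _ _)
  let g : X →+ (Fin n → ℤ) := (c.comp (AddMonoidHom.fst _ _)).comp (AddMonoidHom.snd _ _)
  have hfg : ∀ x : X, x ∈ f.eqLocusM g ↔
      ∀ i, (columnSum A x.1 : Fin n → ℤ) i + x.2.2 i = x.2.1 i := fun x => funext_iff
  obtain ⟨S, hS⟩ := AddSubmonoid.fg_eqLocusM f g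
  refine ⟨S.sup fun x => x.1.degree, fun w => ?_⟩
  -- Both conditions are additive in the triple, so only the generators matter; the constant is the
  -- largest `|v|` among them.
  have key : ∀ x ∈ AddSubmonoid.closure (S : Set X), ∃ v, columnSum A v = columnSum A x.1 ∧
      v.degree ≤ (S.sup fun x => x.1.degree) * (x.2.1.degree + x.2.2.degree) := by
    intro x hx
    induction hx using AddSubmonoid.closure_induction with
    | zero => exact ⟨0, rfl, by simp⟩
    | mem x hx =>
      -- A generator with `a = b = 0` may have `v ≠ 0`, but it represents the point `0` and `v` can
      -- be replaced by `0`. For every other generator `|a| + |b| ≥ 1`, which makes the bound hold.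
      rcases Nat.eq_zero_or_pos (x.2.1.degree + x.2.2.degree) with h | h
      · refine ⟨0, ?_, by simp⟩
        have hx' := (hfg x).1 (hS ▸ AddSubmonoid.subset_closure hx)
        obtain ⟨h1, h2⟩ := Nat.add_eq_zero_iff.1 h
        rw [Finsupp.degree_eq_zero_iff] at h1 h2
        ext i
        simpa [h1, h2] using (hx' i).symm
      · exact ⟨x.1, rfl, (Finset.le_sup (f := fun x : X => x.1.degree) hx).trans
          (Nat.le_mul_of_pos_right _ h)⟩
    | add x y hx hy ihx ihy =>
      obtain ⟨v, hv, hd⟩ := ihx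
      obtain ⟨v', hv', hd'⟩ := ihy
      refine ⟨v + v', by rw [map_add, hv, hv', ← map_add]; rfl, ?_⟩
      rw [Prod.snd_add, Prod.fst_add, Prod.snd_add, map_add, map_add, map_add]
      linarith
  obtain ⟨v₀, hv₀⟩ := columnSum_surjective A w
  -- With the positive and negative parts of `w`, the number `|a| + |b|` is exactly `∑ |w_i|`.
  let a : Fin n →₀ ℕ := Finsupp.equivFunOnFinite.symm fun i => ((w : Fin n → ℤ) i).toNat
  let b : Fin n →₀ ℕ := Finsupp.equivFunOnFinite.symm fun i => (-(w : Fin n → ℤ) i).toNat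
  have hmem : ((v₀, a, b) : X) ∈ f.eqLocusM g := by
    refine (hfg _).2 fun i => ?_
    simp only [hv₀, a, b, Finsupp.equivFunOnFinite_symm_apply_apply]
    omega
  rw [← hS] at hmem
  obtain ⟨v, hv, hd⟩ := key _ hmem
  refine ⟨v, hv.trans hv₀, hd.trans (Nat.mul_le_mul_left _ (le_of_eq ?_))⟩
  simp only [Finsupp.degree_eq_sum, ← Finset.sum_add_distrib, a, b,
    Finsupp.equivFunOnFinite_symm_apply_apply]
  refine Finset.sum_congr rfl fun i _ => ?_
  omega

/-- The weight of a point of `C(A)` bounds its size. -/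
theorem exists_sum_natAbs_le_polytopeWeight : ∃ R : ℝ, 0 ≤ R ∧ ∀ w : columnMonoid A,
    (∑ i, ((w : Fin n → ℤ) i).natAbs : ℕ) ≤ R * polytopeWeight A w := by
  have hb : Bornology.IsBounded (polytope A) :=
    isBounded_convexHull.2 (((Set.finite_range _).insert _).isBounded)
  obtain ⟨B, hB⟩ := hb.exists_norm_le
  have hB0 : 0 ≤ B := (norm_nonneg _).trans (hB 0 (subset_convexHull _ _ (Or.inl rfl)))
  -- If `w ∈ aΔ`, every coordinate is at most `B a` in absolute value, so the sum is at most `n B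
  -- a`. The added `1` makes the constant positive, so that one can divide by it before passing to
  -- the infimum.
  refine ⟨n * B + 1, by positivity, fun w => ?_⟩
  have key : ∀ a : ℝ, 0 < a → (fun i => ((w : Fin n → ℤ) i : ℝ)) ∈ a • polytope A →
      ((∑ i, ((w : Fin n → ℤ) i).natAbs : ℕ) : ℝ) ≤ n * B * a := by
    rintro a ha ⟨y, hy, hya⟩
    have h1 : ∀ i, (((w : Fin n → ℤ) i).natAbs : ℝ) ≤ B * a := by
      intro i
      have h2 : ((w : Fin n → ℤ) i : ℝ) = a * y i := by simpa using (congrFun hya i).symm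
      rw [Nat.cast_natAbs, Int.cast_abs, h2, abs_mul, abs_of_pos ha, mul_comm]
      gcongr
      exact (norm_le_pi_norm y i).trans (hB y hy)
    push_cast
    calc _ ≤ ∑ _i : Fin n, B * a := Finset.sum_le_sum fun i _ => by simpa using h1 i
      _ = _ := by simp; ring
  rw [← div_le_iff₀' (by positivity)]
  refine le_csInf (exists_mem_smul_polytope A w) fun a ha => ?_
  rw [div_le_iff₀' (by positivity)]
  linarith [key a ha.1 ha.2, ha.1]

/-- A representative of `w ∈ C(A)` as a combination of columns. -/
theorem exists_section : ∃ ν : columnMonoid A → (Fin N →₀ ℕ), (∀ w, columnSum A (ν w) = w) ∧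
    ∃ D : ℕ, (∀ w, ((ν w).degree : ℝ) ≤ D * polytopeWeight A w) := by
  obtain ⟨D, hD⟩ := exists_columnSum_eq_degree_le A
  obtain ⟨R, hR0, hR⟩ := exists_sum_natAbs_le_polytopeWeight A
  choose ν h1 h2 using hD
  -- The constant is rounded up to a natural number because it later serves as an exponent of a
  -- radius `σ`.
  obtain ⟨k, hk⟩ := exists_nat_ge (D * R)
  refine ⟨ν, h1, k, fun w => ?_⟩
  calc ((ν w).degree : ℝ) ≤ (D * ∑ i, ((w : Fin n → ℤ) i).natAbs : ℕ) := by exact_mod_cast h2 w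
    _ = D * (∑ i, ((w : Fin n → ℤ) i).natAbs : ℕ) := by push_cast; rfl
    _ ≤ D * (R * polytopeWeight A w) := by gcongr; exact hR w
    _ = (D * R) * polytopeWeight A w := by ring
    _ ≤ _ := by gcongr; exact polytopeWeight_nonneg A w

/-- The weight of a combination of columns is at most its degree. -/
theorem polytopeWeight_columnSum_le (v : Fin N →₀ ℕ) :
    polytopeWeight A (columnSum A v) ≤ v.degree := by
  -- The available step bound adds one column to an arbitrary point; the extra summand `w` lets
  -- these steps be chained.
  have key : ∀ w, polytopeWeight A (columnSum A v + w) ≤ polytopeWeight A w + v.degree := by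
    induction v using Finsupp.induction_linear with
    | zero => simp
    | add v v' h h' =>
      intro w
      rw [map_add, map_add, add_assoc]
      push_cast
      linarith [h (columnSum A v' + w), h' w]
    | single j k =>
      intro w
      induction k with
      | zero => simp
      | succ k ih =>
        rw [add_comm k, Finsupp.single_add, map_add, columnSum_single, add_assoc]
        refine ((isWeight_polytopeWeight A).step j _).trans ?_
        simp only [map_add, Finsupp.degree_single] at ih ⊢
        push_cast
        linarith
  -- The infimum runs over `a > 0` and is not attained here: `0 ∈ εΔ` for every `ε > 0`.
  have h0 : polytopeWeight A 0 ≤ 0 := by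
    refine le_of_forall_pos_le_add fun ε hε => ?_
    refine csInf_le ⟨0, fun b hb => hb.1.le⟩ ⟨by linarith, ?_⟩
    refine ⟨0, subset_convexHull _ _ (Or.inl rfl), ?_⟩
    ext i
    simp
  have h1 := key 0
  rw [add_zero] at h1
  linarith

end Semigroup

end GKZ

namespace GKZ

/-! ### Bounds for products with monomials -/

section Shift

variable {K : Type*} [NormedField K] {N : ℕ}

theorem shift_single {M : Type*} [AddCommMonoid M] [IsCancelAdd M] [DecidableEq M] (e m : M)
    (a : MvPowerSeries (Fin N) K) :
    shift e (Pi.single m a : FormalSums K N M) = Pi.single (e + m) a := by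
  ext1 m'
  by_cases h : ∃ k, e + k = m'
  · obtain ⟨k, rfl⟩ := h
    rw [shift_add_apply]
    simp [Pi.single_apply]
  · rw [shift_apply_of_not h, Pi.single_eq_of_ne]
    rintro rfl
    exact h ⟨_, rfl⟩

/-- The total degree is additive, so the constant is multiplied by the exact power `s^{|v|}`. -/
theorem BoundedBy.shift_degree {r s C : ℝ} (hr : 0 ≤ r) (hs : 0 < s)
    {g : FormalSums K N (Fin N →₀ ℕ)} (h : BoundedBy absDeg r s C g) (v : Fin N →₀ ℕ) :
    BoundedBy absDeg r s (s ^ v.degree * C) (GKZ.shift v g) := by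
  intro m u
  by_cases hm : ∃ k, v + k = m
  · obtain ⟨k, rfl⟩ := hm
    rw [shift_add_apply]
    calc _ = s ^ v.degree * (‖MvPowerSeries.coeff u (g k)‖ * r ^ u.degree * s ^ absDeg k) := by
          simp only [absDeg, Real.rpow_natCast, map_add, pow_add]
          ring
      _ ≤ _ := by gcongr; exact h k u
  · rw [shift_apply_of_not hm]
    have := h.nonneg hr hs.le
    simp only [map_zero, norm_zero, zero_mul]
    positivity

theorem BoundedBy.single_one {r s : ℝ} (hs : 0 < s) (v : Fin N →₀ ℕ) :
    BoundedBy absDeg r s (s ^ v.degree) (Pi.single v 1 : FormalSums K N (Fin N →₀ ℕ)) := by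
  classical
  intro m u
  rcases eq_or_ne m v with rfl | hm
  · rw [Pi.single_eq_same, MvPowerSeries.coeff_one]
    split_ifs with h
    · simp [h, absDeg]
    · simp only [norm_zero, zero_mul]
      positivity
  · rw [Pi.single_eq_of_ne hm]
    simp only [map_zero, norm_zero, zero_mul]
    positivity

/-- By continuity of `x^k` at `1`. Passing from `s` to `σ` absorbs a growth of degrees by the factor
`k`. -/
theorem exists_pow_lt_of_one_lt {s : ℝ} (hs : 1 < s) (k : ℕ) : ∃ σ : ℝ, 1 < σ ∧ σ ^ k < s := by
  have h : Filter.Tendsto (fun x : ℝ => x ^ k) (nhdsWithin 1 (Set.Ioi 1)) (nhds 1) := by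
    simpa using ((continuous_pow k).tendsto (1 : ℝ)).mono_left nhdsWithin_le_nhds
  obtain ⟨σ, h1, h2⟩ := ((h.eventually (gt_mem_nhds hs)).and self_mem_nhdsWithin).exists
  exact ⟨σ, h2, h1⟩

end Shift

/-! ### Finitely many binomials generate all toric relations -/

section Syzygies

variable {n N : ℕ} (A : Matrix (Fin n) (Fin N) ℤ)

/-- The positive part of an integer vector, as an exponent. -/
noncomputable def posExponent (l : Fin N → ℤ) : Fin N →₀ ℕ :=
  Finsupp.equivFunOnFinite.symm fun j => (l j).toNat

theorem columnSum_posExponent {l : Fin N → ℤ} (hl : l ∈ relations A) :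
    columnSum A (posExponent l) = columnSum A (posExponent (-l)) := by
  ext i
  rw [coe_columnSum, coe_columnSum, ← sub_eq_zero, ← Finset.sum_sub_distrib, ← hl i]
  refine Finset.sum_congr rfl fun j _ => ?_
  rw [← sub_mul]
  congr 1
  simp only [posExponent, Finsupp.equivFunOnFinite_symm_apply_apply, Pi.neg_apply]
  omega

/-- There are finitely many relations such that every difference `Tᵛ - Tᵛ'` of monomials with the
same image in `C(A)` is a combination of the corresponding binomials, with coefficients of degree
at most `|v| + |v'|`. -/
theorem exists_finite_relations (K : Type*) [NormedField K] [IsUltrametricDist K] :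
    ∃ (m : ℕ) (μ : Fin m → Fin N → ℤ), (∀ i, μ i ∈ relations A) ∧
      ∀ v v' : Fin N →₀ ℕ, columnSum A v = columnSum A v' →
        ∃ H : Fin m → FormalSums K N (Fin N →₀ ℕ),
          (∀ i r s, 0 < r → 1 ≤ s → BoundedBy absDeg r s (s ^ (v.degree + v'.degree)) (H i)) ∧
          ∑ i, (shift (posExponent (μ i)) (H i) - shift (posExponent (-μ i)) (H i)) =
            Pi.single v 1 - Pi.single v' 1 := by
  -- The pairs of exponents with the same image in `C(A)` form the equalizer of two homomorphisms,
  -- hence a finitely generated monoid. The relations `μ` are the differences of the two entries of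
  -- each generator.
  let X := (Fin N →₀ ℕ) × (Fin N →₀ ℕ)
  let f : X →+ columnMonoid A := (columnSum A).comp (AddMonoidHom.fst _ _)
  let g : X →+ columnMonoid A := (columnSum A).comp (AddMonoidHom.snd _ _)
  have hfg : ∀ x : X, x ∈ f.eqLocusM g ↔ columnSum A x.1 = columnSum A x.2 := fun x => Iff.rfl
  obtain ⟨S, hS⟩ := AddSubmonoid.fg_eqLocusM f g
  let x (i : Fin S.card) : X := (S.equivFin.symm i).1
  refine ⟨S.card, fun i j => ((x i).1 j : ℤ) - (x i).2 j, fun i k => ?_, ?_⟩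
  · have hx : columnSum A (x i).1 = columnSum A (x i).2 :=
      (hfg _).1 (hS ▸ AddSubmonoid.subset_closure (S.equivFin.symm i).2)
    simp only [sub_mul, Finset.sum_sub_distrib]
    rw [← coe_columnSum, ← coe_columnSum, hx, sub_self]
  · set μ : Fin S.card → Fin N → ℤ := fun i j => ((x i).1 j : ℤ) - (x i).2 j with hμ
    -- The multipliers `H` do not involve `x`, so one choice satisfies the bound for all radii at
    -- once; this leaves `σ` free to be chosen later.
    have key : ∀ y ∈ AddSubmonoid.closure (S : Set X),
        ∃ H : Fin S.card → FormalSums K N (Fin N →₀ ℕ),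
          (∀ i r s, 0 < r → 1 ≤ s → BoundedBy absDeg r s (s ^ (y.1.degree + y.2.degree)) (H i)) ∧
          ∑ i, (shift (posExponent (μ i)) (H i) - shift (posExponent (-μ i)) (H i)) =
            Pi.single y.1 1 - Pi.single y.2 1 := by
      intro y hy
      induction hy using AddSubmonoid.closure_induction with
      | zero =>
        refine ⟨0, fun i r s hr hs => BoundedBy.zero.mono_const (by positivity), ?_⟩
        simp
      | mem y hy =>
        obtain ⟨i, hi⟩ : ∃ i, x i = y := ⟨S.equivFin ⟨y, hy⟩, by simp [x]⟩
        -- For a generator `(y₁, y₂)` the entries may share a common part: `y₁ = μ⁺ + (y₁ ⊓ y₂)` and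
        -- `y₂ = μ⁻ + (y₁ ⊓ y₂)`. The multiplier is the monomial of that common part.
        refine ⟨Pi.single i (Pi.single (y.1 ⊓ y.2) 1), fun k r s hr hs => ?_, ?_⟩
        · rcases eq_or_ne k i with rfl | hk
          · rw [Pi.single_eq_same]
            refine (BoundedBy.single_one (by linarith) _).mono_const ?_
            refine pow_le_pow_right₀ hs ?_
            exact (Finsupp.degree_mono inf_le_left).trans (Nat.le_add_right _ _)
          · rw [Pi.single_eq_of_ne hk]
            exact BoundedBy.zero.mono_const (by positivity)
        · rw [Finset.sum_eq_single i]
          · rw [Pi.single_eq_same, shift_single, shift_single]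
            congr 2
            · ext j
              simp only [posExponent, hμ, hi, Finsupp.add_apply, Finsupp.inf_apply,
                Finsupp.equivFunOnFinite_symm_apply_apply]
              omega
            · ext j
              simp only [posExponent, hμ, hi, Finsupp.add_apply, Finsupp.inf_apply, Pi.neg_apply,
                Finsupp.equivFunOnFinite_symm_apply_apply]
              omega
          · intro k _ hk
            rw [Pi.single_eq_of_ne hk, map_zero, map_zero, sub_zero]
          · simp
      | add y z hy hz ihy ihz =>
        obtain ⟨H, hH, hH'⟩ := ihy
        obtain ⟨H₂, hH₂, hH₂'⟩ := ihz
        -- This is the telescoping `T^{y₁+z₁} - T^{y₂+z₂} = T^{z₁}(T^{y₁} - T^{y₂}) + T^{y₂}(T^{z₁}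
        -- - T^{z₂})`. The ultrametric inequality keeps the constant at `s` to the total degree,
        -- with no extra factor for the sum.
        refine ⟨fun i => shift z.1 (H i) + shift y.2 (H₂ i), fun i r s hr hs => ?_, ?_⟩
        · have hs0 : 0 < s := by linarith
          refine BoundedBy.add hr hs0 (((hH i r s hr hs).shift_degree hr.le hs0 _).mono_const ?_)
            (((hH₂ i r s hr hs).shift_degree hr.le hs0 _).mono_const ?_)
          all_goals
            rw [← pow_add, Prod.fst_add, Prod.snd_add, map_add, map_add]
            exact pow_le_pow_right₀ hs (by omega)
        · have h1 := congrArg (shift z.1) hH'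
          have h2 := congrArg (shift y.2) hH₂'
          simp only [map_sum, map_sub, shift_shift, shift_single] at h1 h2
          simp only [map_add, shift_shift]
          rw [add_comm z.1 y.2] at h1
          calc _ = ∑ i, (shift (z.1 + posExponent (μ i)) (H i) -
                  shift (z.1 + posExponent (-μ i)) (H i)) +
                ∑ i, (shift (y.2 + posExponent (μ i)) (H₂ i) -
                  shift (y.2 + posExponent (-μ i)) (H₂ i)) := by
                rw [← Finset.sum_add_distrib]
                refine Finset.sum_congr rfl fun i _ => ?_
                simp only [add_comm z.1, add_comm y.2]
                abel
            _ = _ := by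
                rw [h1, h2, add_comm z.1 y.1]
                abel
    intro v v' h
    exact key (v, v') (hS ▸ (hfg _).2 h)

end Syzygies

/-! ### The map `φ`: surjectivity and kernel -/

section Phi

variable {n N : ℕ} {p : ℕ} [Fact p.Prime] {K : Type*} [NormedField K] [NormedAlgebra ℚ_[p] K]
  [FiniteDimensional ℚ_[p] K] {A : Matrix (Fin n) (Fin N) ℤ} {ϖ : DworkPi p K}

theorem box_eq (l : Fin N → ℤ) :
    box ϖ l = DDagger.dpow (posExponent l) - DDagger.dpow (posExponent (-l)) := rfl

theorem coe_phi (P : DDagger ϖ N) : ((phi A ϖ P : LPrime A K) : FormalSums K N (columnMonoid A)) =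
    act (ϖ : K) (column A) P.symbol (Pi.single 0 1) := rfl

/-- Applying `∇^v / π^{|v|}` to `1` gives the monomial `t^{∑ v_j w_j}`, so the coefficient of `φ(P)`
at `t^w` is the sum of the `f_v` over the fibre of `columnSum` above `w`. -/
theorem hasSum_phi (P : DDagger ϖ N) (w : columnMonoid A) :
    HasSum (fun v => P.symbol v * (Pi.single (columnSum A v) 1 : FormalSums K N (columnMonoid A)) w)
      ((phi A ϖ P : LPrime A K).1 w) := by
  have := isUltrametricDist_of_padic p K
  have := completeSpace_of_padic p K
  have h := (summable_act ϖ.factorialBound (isWeight_polytopeWeight A) P.isOverconvergent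
    (1 : LPrime A K).2).hasSum
  have h1 : (fun v => P.symbol v *
      (Pi.single (columnSum A v) 1 : FormalSums K N (columnMonoid A)) w) =
      fun v => (P.symbol v • deltaPow (ϖ : K) (column A) v (1 : LPrime A K).1) w := by
    ext1 v
    change _ = P.symbol v * deltaPow (ϖ : K) (column A) v (Pi.single 0 1) w
    rw [deltaPow_single_one ϖ.factorialBound.1, add_zero]
    rfl
  rw [h1]
  exact Pi.hasSum.1 h w

/-- The right factor has constant coefficients, so composition differentiates nothing and only adds
exponents. The left ideal generated by the box operators can therefore be handled as if the `T^v`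
were commuting monomials over the power series. -/
theorem symbol_mul_dpow (Q : DDagger ϖ N) (u : Fin N →₀ ℕ) :
    (Q * DDagger.dpow u).symbol = shift u Q.symbol := by
  have := isUltrametricDist_of_padic p K
  have := completeSpace_of_padic p K
  have h := (summable_act ϖ.factorialBound isWeight_absDeg Q.isOverconvergent
    (DDagger.dpow u : DDagger ϖ N).isOverconvergent).hasSum
  ext1 m
  refine (Pi.hasSum.1 h m).unique ?_
  have h1 : ∀ v, (Q.symbol v • deltaPow (ϖ : K) (fun j => Finsupp.single j 1) v
      (DDagger.dpow u : DDagger ϖ N).symbol) m =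
      Q.symbol v * (Pi.single (u + v) 1 : FormalSums K N (Fin N →₀ ℕ)) m := by
    intro v
    rw [DDagger.dpow, DDagger.symbol_ofSymbol, deltaPow_single_one ϖ.factorialBound.1]
    have : (∑ j, v j • Finsupp.single j 1 : Fin N →₀ ℕ) = v := by simp
    rw [this, add_comm]
    rfl
  simp only [h1]
  by_cases hm : ∃ v, u + v = m
  · obtain ⟨v, rfl⟩ := hm
    rw [shift_add_apply]
    convert hasSum_single v fun v' hv' => ?_ using 1
    · simp
    · rw [Pi.single_eq_of_ne, mul_zero]
      simpa using hv'.symm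
  · rw [shift_apply_of_not hm]
    convert hasSum_zero with v
    rw [Pi.single_eq_of_ne, mul_zero]
    rintro rfl
    exact hm ⟨v, rfl⟩

theorem phi_dpow (v : Fin N →₀ ℕ) :
    ((phi A ϖ (DDagger.dpow v) : LPrime A K) : FormalSums K N (columnMonoid A)) =
      Pi.single (columnSum A v) 1 := by
  have := isUltrametricDist_of_padic p K
  have := completeSpace_of_padic p K
  rw [coe_phi, DDagger.dpow, DDagger.symbol_ofSymbol, act_single, one_smul,
    deltaPow_single_one ϖ.factorialBound.1, add_zero]
  rfl

theorem phi_box {l : Fin N → ℤ} (hl : l ∈ relations A) : phi A ϖ (box ϖ l) = 0 := by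
  rw [box_eq, map_sub, sub_eq_zero]
  apply Subtype.ext
  rw [phi_dpow, phi_dpow, columnSum_posExponent A hl]

/-- A preimage is supported on the image of the section `ν`, where each fibre contributes a single
coefficient. It is overconvergent because `σ^{|ν(w)|} ≤ (σ^D)^{d(w)} ≤ s^{d(w)}`. -/
theorem phi_surjective : Function.Surjective (phi A ϖ) := by
  classical
  intro g
  obtain ⟨ν, hν, D, hD⟩ := exists_section A
  obtain ⟨r, hr, s, hs, C, hg⟩ := g.2
  have hC : 0 ≤ C := hg.nonneg (by linarith) (by linarith)
  obtain ⟨σ, hσ, hσs⟩ := exists_pow_lt_of_one_lt hs D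
  have hσ0 : 0 < σ := by linarith
  let f : FormalSums K N (Fin N →₀ ℕ) := fun v =>
    if ν (columnSum A v) = v then g.1 (columnSum A v) else 0
  have hf : IsOverconvergent absDeg f := by
    refine ⟨r, hr, σ, hσ, C, fun v u => ?_⟩
    simp only [f]
    split_ifs with h
    · refine le_trans ?_ (hg (columnSum A v) u)
      gcongr
      calc σ ^ absDeg v ≤ σ ^ (D * polytopeWeight A (columnSum A v)) := by
            refine Real.rpow_le_rpow_of_exponent_le hσ.le ?_
            have := hD (columnSum A v)
            rwa [h] at this
        _ = (σ ^ D) ^ polytopeWeight A (columnSum A v) := by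
            rw [Real.rpow_mul hσ0.le, Real.rpow_natCast]
        _ ≤ _ := by
            refine Real.rpow_le_rpow (by positivity) hσs.le (polytopeWeight_nonneg A _)
    · simpa using hC
  refine ⟨DDagger.ofSymbol f hf, Subtype.ext (funext fun w => ?_)⟩
  refine (hasSum_phi _ w).unique ?_
  rw [DDagger.symbol_ofSymbol]
  convert hasSum_single (ν w) fun v hv => ?_ using 1
  · simp [f, hν]
  · by_cases h : columnSum A v = w
    · have : ν (columnSum A v) ≠ v := fun h' => hv (by rw [← h, h'])
      simp [f, this]
    · rw [Pi.single_eq_of_ne (Ne.symm h), mul_zero]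

/-- The operators that annihilate `1 ∈ L†′` are combinations of finitely many box operators. -/
theorem exists_span_box_eq_ker : ∃ (m : ℕ) (μ : Fin m → Fin N → ℤ), (∀ i, μ i ∈ relations A) ∧
    LinearMap.ker (phi A ϖ) ≤ Submodule.span (DDagger ϖ N) (Set.range fun i => box ϖ (μ i)) := by
  classical
  have := isUltrametricDist_of_padic p K
  have := completeSpace_of_padic p K
  obtain ⟨m, μ, hμ, hsyz⟩ := exists_finite_relations A K
  refine ⟨m, μ, hμ, fun P hP => ?_⟩
  obtain ⟨ν, hν, D, hD⟩ := exists_section A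
  -- Each `T^v` is compared with the chosen monomial of its fibre.
  choose H hH hH' using fun v => hsyz v (ν (columnSum A v)) (hν _).symm
  obtain ⟨r, hr, s, hs, C, hf⟩ := P.isOverconvergent
  have hC : 0 ≤ C := hf.nonneg (by linarith) (by linarith)
  -- The exponent is `D + 1` because `|v| + |ν(columnSum v)| ≤ |v| + D d(columnSum v) ≤ (D + 1)|v|`.
  obtain ⟨σ, hσ, hσs⟩ := exists_pow_lt_of_one_lt hs (D + 1)
  have hσ0 : 0 < σ := by linarith
  have hs0 : 0 < s := by linarith
  have hq : σ ^ (D + 1) / s < 1 := (div_lt_one hs0).2 hσs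
  have hq0 : 0 ≤ σ ^ (D + 1) / s := by positivity
  have hdeg : ∀ v, v.degree + (ν (columnSum A v)).degree ≤ (D + 1) * v.degree := by
    intro v
    have h1 : ((ν (columnSum A v)).degree : ℝ) ≤ D * v.degree :=
      (hD _).trans (by gcongr; exact polytopeWeight_columnSum_le A v)
    have h2 : (ν (columnSum A v)).degree ≤ D * v.degree := by exact_mod_cast h1
    linarith
  -- The decay `s^{-|v|}` of `f_v` beats the growth `σ^{(D+1)|v|}` of the multipliers, leaving a
  -- geometric series of ratio less than `1`.
  have hG : ∀ i v, BoundedBy absDeg r σ (C * (σ ^ (D + 1) / s) ^ v.degree)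
      (P.symbol v • H v i) := by
    intro i v
    refine (BoundedBy.smul (C' := C / s ^ v.degree) (by linarith) hσ0 (by positivity)
      (hH v i r σ (by linarith) hσ.le) fun u => ?_).mono_const ?_
    · rw [le_div_iff₀ (by positivity)]
      have := hf v u
      rwa [absDeg, Real.rpow_natCast] at this
    · rw [div_pow, ← pow_mul, div_mul_eq_mul_div, mul_div_assoc]
      gcongr
      · exact hσ.le
      · exact hdeg v
  have hsum : ∀ i, Summable fun v => P.symbol v • H v i := fun i =>
    summable_of_boundedBy absDeg_nonneg hr.le hσ.le (hG i) (tendsto_geometric hq0 hq C)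
  let Q (i : Fin m) : DDagger ϖ N := DDagger.ofSymbol (∑' v, P.symbol v • H v i)
    ⟨r, hr, σ, hσ, C, boundedBy_tsum hC (by linarith) hσ0 (fun v => (hG i v).mono_const
      (mul_le_of_le_one_right hC (pow_le_one₀ hq0 hq.le))) (hsum i)⟩
  have hPQ : P = ∑ i, Q i * box ϖ (μ i) := by
    -- The sum of `f_v (T^v - T^{ν(columnSum v)})` is evaluated in two ways: through the binomials
    -- it is `∑ Q_i □_{μ_i}`, and directly it is `P`, since the subtracted terms cancel.
    have h1 : HasSum (fun v => P.symbol v • (Pi.single v 1 - Pi.single (ν (columnSum A v)) 1 :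
        FormalSums K N (Fin N →₀ ℕ))) (∑ i, (shift (posExponent (μ i)) (Q i).symbol -
          shift (posExponent (-μ i)) (Q i).symbol)) := by
      have h2 : ∀ i (u : Fin N →₀ ℕ), HasSum (fun v => shift u (P.symbol v • H v i))
          (shift u (Q i).symbol) := fun i u => (hsum i).hasSum.map (shift u) (continuous_shift u)
      have h3 : (fun v => P.symbol v • (Pi.single v 1 - Pi.single (ν (columnSum A v)) 1 :
          FormalSums K N (Fin N →₀ ℕ))) = fun v => ∑ i,
            (shift (posExponent (μ i)) (P.symbol v • H v i) -
              shift (posExponent (-μ i)) (P.symbol v • H v i)) := by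
        ext1 v
        rw [← hH' v, Finset.smul_sum]
        simp only [map_smul, smul_sub]
      rw [h3]
      exact hasSum_sum fun i _ => (h2 i (posExponent (μ i))).sub (h2 i (posExponent (-μ i)))
    have h3 : (∑ i, Q i * box ϖ (μ i)).symbol = ∑ i, (shift (posExponent (μ i)) (Q i).symbol -
          shift (posExponent (-μ i)) (Q i).symbol) := by
      have h4 : ∀ i, (Q i * box ϖ (μ i)).symbol = shift (posExponent (μ i)) (Q i).symbol -
          shift (posExponent (-μ i)) (Q i).symbol := by
        intro i
        rw [box_eq, mul_sub, ← symbol_mul_dpow, ← symbol_mul_dpow]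
        rfl
      simp only [← h4]
      exact map_sum (AddMonoidHom.mk' DDagger.symbol DDagger.symbol_add) _ _
    apply DDagger.symbol_injective
    rw [h3]
    ext1 u
    refine HasSum.unique ?_ (Pi.hasSum.1 h1 u)
    have h5 : HasSum (fun v => P.symbol v * (Pi.single v 1 : FormalSums K N (Fin N →₀ ℕ)) u)
        (P.symbol u) := by
      convert hasSum_single u fun v hv => ?_ using 1
      · simp
      · rw [Pi.single_eq_of_ne (Ne.symm hv), mul_zero]
    -- Here `φ(P) = 0` enters. As `ν` is injective, the coefficient of `∑ f_v T^{ν(columnSum v)}` at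
    -- `ν(w)` is that of `φ(P)` at `t^w`; outside the image of `ν` every term is zero.
    have h6 : HasSum (fun v => P.symbol v *
        (Pi.single (ν (columnSum A v)) 1 : FormalSums K N (Fin N →₀ ℕ)) u) 0 := by
      by_cases hu : ∃ w, ν w = u
      · obtain ⟨w, rfl⟩ := hu
        have hinj : Function.Injective ν := Function.LeftInverse.injective hν
        have h7 := hasSum_phi (A := A) P w
        rw [LinearMap.mem_ker.1 hP] at h7
        have h8 : ∀ v, (Pi.single (ν (columnSum A v)) 1 : FormalSums K N (Fin N →₀ ℕ)) (ν w) =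
            (Pi.single (columnSum A v) 1 : FormalSums K N (columnMonoid A)) w := fun v => by
          simp [Pi.single_apply, hinj.eq_iff]
        simp only [h8]
        exact h7
      · convert hasSum_zero with v
        rw [Pi.single_eq_of_ne, mul_zero]
        rintro rfl
        exact hu ⟨_, rfl⟩
    have h7 := h5.sub h6
    simp only [← mul_sub, sub_zero] at h7
    exact h7
  rw [hPQ]
  exact Submodule.sum_mem _ fun i _ => Submodule.smul_mem _ _ (Submodule.subset_span ⟨i, rfl⟩)

theorem ker_phi : LinearMap.ker (phi A ϖ) = boxIdeal A ϖ := by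
  refine le_antisymm ?_ (Submodule.span_le.2 ?_)
  · obtain ⟨m, μ, hμ, h⟩ := exists_span_box_eq_ker (A := A) (ϖ := ϖ)
    refine h.trans (Submodule.span_mono ?_)
    rintro _ ⟨i, rfl⟩
    exact ⟨_, hμ i, rfl⟩
  · rintro _ ⟨l, hl, rfl⟩
    exact phi_box hl

/-- The box ideal equals the kernel of `φ`, and that kernel already lies in the span of the finitely
many boxes. -/
theorem exists_finite_span_box_eq_boxIdeal : ∃ (m : ℕ) (μ : Fin m → Fin N → ℤ),
    (∀ i, μ i ∈ relations A) ∧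
      Submodule.span (DDagger ϖ N) (Set.range fun i => box ϖ (μ i)) = boxIdeal A ϖ := by
  obtain ⟨m, μ, hμ, h⟩ := exists_span_box_eq_ker (A := A) (ϖ := ϖ)
  refine ⟨m, μ, hμ, le_antisymm (Submodule.span_mono ?_) (ker_phi.symm.le.trans h)⟩
  rintro _ ⟨i, rfl⟩
  exact ⟨_, hμ i, rfl⟩

end Phi

end GKZ

/-! ### Quotients and cohomology in top degree -/

namespace GKZ

/-- A surjective linear map induces an isomorphism of quotients. -/
theorem exists_quotient_equiv {R M M' : Type*} [Ring R] [AddCommGroup M] [AddCommGroup M']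
    [Module R M] [Module R M'] (f : M →ₗ[R] M') (hf : Function.Surjective f) {I : Submodule R M}
    {J : Submodule R M'} (h : J.comap f = I) :
    ∃ e : (M ⧸ I) ≃ₗ[R] (M' ⧸ J), ∀ x, e (Submodule.Quotient.mk x) = Submodule.Quotient.mk (f x) := by
  refine ⟨LinearEquiv.ofBijective (I.mapQ J f h.ge) ⟨?_, ?_⟩, fun x => rfl⟩
  · rw [← LinearMap.ker_eq_bot, Submodule.ker_mapQ, h, Submodule.mkQ_map_self]
  · rw [← LinearMap.range_eq_top, Submodule.range_mapQ, LinearMap.range_eq_top.2 hf,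
      Submodule.map_top, Submodule.range_mkQ]

section TopCohomology

variable {R L : Type*} [Ring R] [AddCommGroup L] [Module R L] {n : ℕ}

instance : Unique {s : Finset (Fin n) // s.card = n} where
  default := ⟨Finset.univ, by simp⟩
  uniq s := Subtype.ext ((Finset.card_eq_iff_eq_univ _).1 (by simpa using s.2))

theorem topForm_surjective (F : Fin n → L →ₗ[R] L) : Function.Surjective (topForm F) := by
  intro ω
  refine ⟨ω.1 default, Subtype.ext (funext fun s => ?_)⟩
  rw [Unique.eq_default s]
  rfl

/-- The single coefficient of a top-degree boundary is `∑ ±F_i(ω_i)`, where `ω_i` is the coefficient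
at the complement of `i`. These coefficients are independent, so the boundaries fill the sum of the
ranges. -/
theorem topForm_mem_boundaries_iff (F : Fin n → L →ₗ[R] L) (f : L) :
    (topForm F f : Forms L n n) ∈ boundaries F n ↔ f ∈ ⨆ i, LinearMap.range (F i) := by
  cases n with
  -- For `n = 0` there are no operators and no forms of degree `-1`, so both sides say `f = 0`.
  | zero =>
    have h : (⨆ i, LinearMap.range (F i)) = ⊥ := iSup_of_empty _
    rw [h]
    change (fun _ => f : Forms L 0 0) ∈ (⊥ : Submodule R (Forms L 0 0)) ↔ _
    rw [Submodule.mem_bot, Submodule.mem_bot]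
    exact ⟨fun h => congrFun h default, fun h => funext fun _ => h⟩
  | succ k =>
    constructor
    · rintro ⟨ω, hω⟩
      have h : f = formsD F k ω default := (congrFun hω default).symm
      rw [h, formsD_apply]
      refine Submodule.sum_mem _ fun i _ => zsmul_mem ?_ _
      exact Submodule.mem_iSup_of_mem i.1 ⟨_, rfl⟩
    · intro h
      suffices (⨆ i, LinearMap.range (F i)) ≤
          (LinearMap.range (formsD F k)).comap
            ((LinearMap.ker (formsD F (k + 1))).subtype ∘ₗ topForm F) from this h
      refine iSup_le fun i => ?_
      rintro _ ⟨g, rfl⟩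
      -- The sign of the `i`-th term in the differential. Scaling by it cancels that sign, since its
      -- square is `1`.
      let c : ℤ := (-1) ^ ((default : {s : Finset (Fin (k + 1)) // s.card = k + 1}).1.filter
        (· < i)).card
      let s : {s : Finset (Fin (k + 1)) // s.card = k} := ⟨Finset.univ.erase i, by simp⟩
      have hs : ∀ t, t.1 = Finset.univ.erase i → (Pi.single s (c • g) : Forms L (k + 1) k) t =
          c • g := fun t ht => by
        rw [show t = s from Subtype.ext ht, Pi.single_eq_same]
      refine ⟨Pi.single s (c • g), ?_⟩
      ext1 J
      obtain rfl := Unique.eq_default J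
      change _ = F i g
      rw [formsD_apply, Finset.sum_eq_single ⟨i, Finset.mem_univ i⟩]
      · rw [hs _ rfl, map_zsmul, smul_smul, ← mul_pow]
        simp
      · intro j _ hj
        rw [Pi.single_eq_of_ne, map_zero, smul_zero]
        intro h
        refine hj (Subtype.ext ?_)
        -- Complements of distinct points differ: `j` lies in the complement of `i` but not in its
        -- own.
        by_contra hne
        have h1 : j.1 ∈ (Finset.univ.erase j.1 : Finset (Fin (k + 1))) := by
          have h2 := congrArg Subtype.val h
          change Finset.univ.erase j.1 = Finset.univ.erase i at h2
          rw [h2]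
          simpa using hne
        simp at h1
      · simp

theorem exists_quotient_equiv_cohomology (F : Fin n → L →ₗ[R] L) :
    ∃ e : (L ⧸ ⨆ i, LinearMap.range (F i)) ≃ₗ[R] Cohomology F n,
      ∀ f, e (Submodule.Quotient.mk f) = Submodule.Quotient.mk (topForm F f) :=
  exists_quotient_equiv (topForm F) (topForm_surjective F)
    (Submodule.ext fun f => topForm_mem_boundaries_iff F f)

end TopCohomology

/-! ### Euler operators and the operators `F_{i,γ}` -/

section Euler

variable {n N : ℕ} {p : ℕ} [Fact p.Prime] {K : Type*} [NormedField K] [NormedAlgebra ℚ_[p] K]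
  [FiniteDimensional ℚ_[p] K] {A : Matrix (Fin n) (Fin N) ℤ} {ϖ : DworkPi p K}

theorem coe_phi_of_symbol_eq_single {P : DDagger ϖ N} {v : Fin N →₀ ℕ}
    {a : MvPowerSeries (Fin N) K} (h : P.symbol = Pi.single v a) :
    ((phi A ϖ P : LPrime A K) : FormalSums K N (columnMonoid A)) =
      a • Pi.single (columnSum A v) 1 := by
  have := isUltrametricDist_of_padic p K
  have := completeSpace_of_padic p K
  rw [coe_phi, h, act_single, deltaPow_single_one ϖ.factorialBound.1, add_zero]
  rfl

theorem symbol_smul (c : K) (P : DDagger ϖ N) : (c • P).symbol = c • P.symbol := rfl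

/-- With `x_j` on the left no commutator term arises. The factor `π` appears because symbols are
written in powers of `π⁻¹∂`. -/
theorem symbol_x_mul_d (j : Fin N) :
    (DDagger.x j * DDagger.d j : DDagger ϖ N).symbol =
      Pi.single (Finsupp.single j 1) ((ϖ : K) • MvPowerSeries.X j) := by
  have := isUltrametricDist_of_padic p K
  have := completeSpace_of_padic p K
  have hx : (DDagger.x j : DDagger ϖ N).symbol =
      (Pi.single 0 (MvPowerSeries.X j) : FormalSums K N (Fin N →₀ ℕ)) := rfl
  rw [DDagger.symbol_mul, hx, act_single, deltaPow_zero,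
    Module.End.one_apply, DDagger.d, symbol_smul, DDagger.dpow, DDagger.symbol_ofSymbol,
    ← Pi.single_smul, ← Pi.single_smul]
  congr 1
  rw [smul_eq_mul, MvPowerSeries.smul_eq_C_mul, MvPowerSeries.smul_eq_C_mul, mul_one, mul_comm]

/-- Since `∂_j · 1 = π t^{w_j}`, the Euler operator sends `1` to `γ_i + π ∑ w_{ij} x_j t^{w_j}`.
This is `F_{i,γ}(1)`, because `t_i ∂/∂t_i` kills `1`. -/
theorem phi_opE (γ : Fin n → K) (i : Fin n) : phi A ϖ (opE A ϖ γ i) = opF A ϖ γ i 1 := by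
  have h1 : ∀ j, ((phi A ϖ ((A i j : K) • (DDagger.x j * DDagger.d j)) : LPrime A K) :
      FormalSums K N (columnMonoid A)) =
      (ϖ : K) • (A i j : K) • (MvPowerSeries.X j : MvPowerSeries (Fin N) K) •
        shift (column A j) (Pi.single 0 1) := by
    intro j
    rw [coe_phi_of_symbol_eq_single (v := Finsupp.single j 1)
      (a := (A i j : K) • (ϖ : K) • MvPowerSeries.X j), columnSum_single, shift_single, add_zero,
      smul_assoc, smul_assoc, smul_comm]
    rw [symbol_smul, symbol_x_mul_d, Pi.single_smul, Pi.single_smul, Pi.single_smul]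
  have h2 : ((phi A ϖ (γ i • 1) : LPrime A K) : FormalSums K N (columnMonoid A)) =
      γ i • Pi.single 0 1 := by
    rw [coe_phi_of_symbol_eq_single (v := 0) (a := γ i • 1), map_zero, smul_assoc, one_smul]
    rw [symbol_smul, DDagger.symbol_one, Pi.single_smul]
  have h3 : tDeriv i (Pi.single 0 1 : FormalSums K N (columnMonoid A)) = 0 := by
    ext1 w
    rcases eq_or_ne w 0 with rfl | hw
    · simp [tDeriv]
    · simp [tDeriv, Pi.single_eq_of_ne hw]
  apply Subtype.ext
  change _ = formalF A (ϖ : K) γ i (Pi.single 0 1)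
  rw [formalF_apply, mulPiF_apply, h3, zero_add, opE, map_add, map_sum, Submodule.coe_add, h2,
    add_comm, Finset.smul_sum, ← Finset.sum_congr rfl fun j _ => h1 j]
  congr 1
  exact map_sum (LPrime A K).subtype _ _

/-- Every element of `L†′` is `P · 1`, and `F_{i,γ}(P · 1) = P · F_{i,γ}(1) = P · φ(E_{i,γ})` by
`D†`-linearity. -/
theorem map_phi_eulerIdeal (γ : Fin n → K) :
    (eulerIdeal A ϖ γ).map (phi A ϖ) = imageF A ϖ γ := by
  rw [eulerIdeal, Submodule.map_span, imageF]
  refine le_antisymm (Submodule.span_le.2 ?_) (iSup_le fun i => ?_)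
  · rintro _ ⟨_, ⟨i, rfl⟩, rfl⟩
    rw [phi_opE]
    exact Submodule.mem_iSup_of_mem i ⟨1, rfl⟩
  · rintro _ ⟨g, rfl⟩
    obtain ⟨P, rfl⟩ := phi_surjective (A := A) (ϖ := ϖ) g
    change opF A ϖ γ i (P • 1) ∈ _
    rw [map_smul, ← phi_opE]
    exact Submodule.smul_mem _ _ (Submodule.subset_span ⟨_, ⟨i, rfl⟩, rfl⟩)

/-- The preimage of an image is the submodule plus the kernel, and the kernel of `φ` is the box
ideal. -/
theorem comap_phi_imageF (γ : Fin n → K) :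
    (imageF A ϖ γ).comap (phi A ϖ) = eulerIdeal A ϖ γ ⊔ boxIdeal A ϖ := by
  rw [← map_phi_eulerIdeal, Submodule.comap_map_eq, ker_phi]

end Euler

end GKZ

/-! ### The main theorem -/

theorem theorem2 (p : ℕ) [Fact p.Prime] (K : Type*) [NormedField K] [NormedAlgebra ℚ_[p] K]
    [FiniteDimensional ℚ_[p] K] (ϖ : GKZ.DworkPi p K) (n N : ℕ) (A : Matrix (Fin n) (Fin N) ℤ)
    (hA : (A.map (Int.cast : ℤ → ℚ)).rank = n) (γ : Fin n → K) :
    (∃ e : (GKZ.DDagger ϖ N ⧸ GKZ.boxIdeal A ϖ) ≃ₗ[GKZ.DDagger ϖ N] GKZ.LPrime A K,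
      ∀ P : GKZ.DDagger ϖ N, e (Submodule.Quotient.mk P) = GKZ.phi A ϖ P) ∧
    (∃ e : (GKZ.DDagger ϖ N ⧸ (GKZ.eulerIdeal A ϖ γ ⊔ GKZ.boxIdeal A ϖ)) ≃ₗ[GKZ.DDagger ϖ N]
        (GKZ.LPrime A K ⧸ GKZ.imageF A ϖ γ),
      ∀ P : GKZ.DDagger ϖ N,
        e (Submodule.Quotient.mk P) = Submodule.Quotient.mk (GKZ.phi A ϖ P)) ∧
    (∃ e : (GKZ.LPrime A K ⧸ GKZ.imageF A ϖ γ) ≃ₗ[GKZ.DDagger ϖ N]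
        GKZ.Cohomology (GKZ.opF A ϖ γ) n,
      ∀ f : GKZ.LPrime A K,
        e (Submodule.Quotient.mk f) = Submodule.Quotient.mk (GKZ.topForm (GKZ.opF A ϖ γ) f)) ∧
    (∃ (m : ℕ) (μ : Fin m → Fin N → ℤ), (∀ i, μ i ∈ GKZ.relations A) ∧
      Submodule.span (GKZ.DDagger ϖ N) (Set.range fun i => GKZ.box ϖ (μ i)) =
        GKZ.boxIdeal A ϖ) := by
  refine ⟨⟨(Submodule.quotEquivOfEq _ _ GKZ.ker_phi.symm).trans
    ((GKZ.phi A ϖ).quotKerEquivOfSurjective GKZ.phi_surjective), fun P => rfl⟩,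
    GKZ.exists_quotient_equiv (GKZ.phi A ϖ) GKZ.phi_surjective (GKZ.comap_phi_imageF γ),
    GKZ.exists_quotient_equiv_cohomology (GKZ.opF A ϖ γ),
    GKZ.exists_finite_span_box_eq_boxIdeal⟩
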